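/- Let $k$ be an algebraically closed field of characteristic zero and $G$ a finite group. Let $\mathcal Z(G)$ be the braided monoidal category whose objects are finite-dimensional $G$-graded vector spaces $X=\bigoplus_{g\in G}X_g$ over $k$ with a $G$-action such that $f(X_g)=X_{fgf^{-1}}$, and whose morphisms are the linear maps preserving grading and action; the tensor product carries the usual grading and the diagonal action, the unit is $1=k$ in degree $e$ with trivial action, and the braiding is $c_{X,Y}(x\otimes y)=f(y)\otimes x$ for $x\in X_f$, $y\in Y$. Algebras are associative unital algebras $(A,\mu,\iota)$ in $\mathcal Z(G)$. Such an algebra is *commutative* if $\mu c_{A,A}=\mu$. It is *separable* (special Frobenius) if there are morphisms $\epsilon:A\to 1$ and $\kappa:1\to A\otimes A$ such that $e=\epsilon\mu:A\otimes A\to 1$ is a non-degenerate pairing with inverse copairing $\kappa$, that is, $(e\otimes A)(A\otimes\kappa)=\mathrm{id}_A=(A\otimes e)(\kappa\otimes A)$, and such that $\mu\kappa=\iota$. It is *indecomposable* if it is non-zero and not isomorphic to a direct sum of two non-zero algebras in $\mathcal Z(G)$. Consider quadruples $(H,F,\gamma,\varepsilon)$, where $H\subset G$ is a subgroup, $F\lhd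 H$ is a normal subgroup, $\gamma\in Z^2(F,k^*)$ is a normalised 2-cocycle, i.e. $\gamma(e,f)=\gamma(f,e)=1$ and $\gamma(f,g)\gamma(fg,h)=\gamma(g,h)\gamma(f,gh)$ for $f,g,h\in F$, and $\varepsilon:H\times F\to k^*$, $(h,f)\mapsto\varepsilon_h(f)$, satisfies $$\varepsilon_{gh}(f)=\varepsilon_g(hfh^{-1})\,\varepsilon_h(f)\quad(g,h\in H,\ f\in F),$$ $$\gamma(f,g)\,\varepsilon_h(fg)=\varepsilon_h(f)\,\varepsilon_h(g)\,\gamma(hfh^{-1},hgh^{-1})\quad(h\in H,\ f,g\in F),$$ $$\gamma(f,g)=\varepsilon_f(g)\,\gamma(fgf^{-1},f)\quad(f,g\in F).$$ Let $A(H,F,\gamma,\varepsilon)$ be the vector space spanned by elements $a_{g,f}$ with $g\in G$, $f\in F$, modulo the relations $a_{gh,f}=\varepsilon_h(f)\,a_{g,hfh^{-1}}$ for $h\in H$, where $a_{g,f}$ has degree $gfg^{-1}$, the group $G$ acts by $g'(a_{g,f})=a_{g'g,f}$, and the multiplication is determined by $a_{g,f}a_{g,f'}=\gamma(f,f')\,a_{g,ff'}$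 and $a_{g,f}a_{g',f'}=0$ if $gH\neq g'H$; the unit is the sum of the elements $a_{g,e}$ over the cosets $gH\in G/H$. This is a well-defined algebra in $\mathcal Z(G)$. **Theorem.** The indecomposable separable commutative algebras in $\mathcal Z(G)$ are classified by the quadruples $(H,F,\gamma,\varepsilon)$: 1. For every quadruple, the algebra $A(H,F,\gamma,\varepsilon)$ is commutative, separable and indecomposable. 2. Every indecomposable separable commutative algebra in $\mathcal Z(G)$ is isomorphic, as an algebra in $\mathcal Z(G)$, to $A(H,F,\gamma,\varepsilon)$ for some quadruple. 3. The algebras $A(H,F,\gamma,\varepsilon)$ and $A(H',F',\gamma',\varepsilon')$ are isomorphic if and only if there are $x\in G$ with $H'=xHx^{-1}$, $F'=xFx^{-1}$ and a map $c:F\to k^*$ such that, for all $f,g\in F$ and $h\in H$, $$c(fg)\,\gamma(f,g)=\gamma'(xfx^{-1},xgx^{-1})\,c(f)\,c(g),\qquad \varepsilon_h(f)\,c(hfh^{-1})=c(f)\,\varepsilon'_{xhx^{-1}}(xfx^{-1}).$$ -/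

import Mathlib

open CategoryTheory MonoidalCategory TensorProduct

universe u

noncomputable section

section Raw

variable {k G : Type u} [Field k] [Group G]
  {V W U V' W' : Type u} [AddCommGroup V] [Module k V] [AddCommGroup W] [Module k W]
  [AddCommGroup U] [Module k U] [AddCommGroup V'] [Module k V'] [AddCommGroup W'] [Module k W']

/-- Given the projections onto the components of `V` and `W`, the projection of `V ⊗ W` onto
`(V ⊗ W)_g = ⨁_{ab = g} V_a ⊗ W_b`. -/
def tensorProj [Fintype G] (p : G → V →ₗ[k] V) (q : G → W →ₗ[k] W) (g : G) : V ⊗[k] W →ₗ[k] V ⊗[k] W :=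
  ∑ a, TensorProduct.map (p a) (q (a⁻¹ * g))

theorem tensorProj_tmul [Fintype G] (p : G → V →ₗ[k] V) (q : G → W →ₗ[k] W) (g : G) (x : V) (y : W) :
    tensorProj p q g (x ⊗ₜ[k] y) = ∑ a, p a x ⊗ₜ[k] q (a⁻¹ * g) y := by
  simp [tensorProj, LinearMap.sum_apply]

theorem tensorProj_map [Fintype G] (p : G → V →ₗ[k] V) (q : G → W →ₗ[k] W) (p' : G → V' →ₗ[k] V')
    (q' : G → W' →ₗ[k] W') (f : V →ₗ[k] V') (f' : W →ₗ[k] W')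
    (hf : ∀ g v, f (p g v) = p' g (f v)) (hf' : ∀ g v, f' (q g v) = q' g (f' v)) (g : G) :
    TensorProduct.map f f' ∘ₗ tensorProj p q g = tensorProj p' q' g ∘ₗ TensorProduct.map f f' :=
  TensorProduct.ext' fun x y => by simp [tensorProj_tmul, hf, hf']

theorem tensorProj_assoc [Fintype G] (p : G → V →ₗ[k] V) (q : G → W →ₗ[k] W) (r : G → U →ₗ[k] U) (g : G) :
    (TensorProduct.assoc k V W U).toLinearMap ∘ₗ tensorProj (tensorProj p q) r g =
      tensorProj p (tensorProj q r) g ∘ₗ (TensorProduct.assoc k V W U).toLinearMap := by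
  refine TensorProduct.ext_threefold fun x y z => ?_
  simp only [LinearMap.comp_apply, LinearEquiv.coe_coe, TensorProduct.assoc_tmul, tensorProj_tmul,
    TensorProduct.sum_tmul, TensorProduct.tmul_sum, map_sum]
  rw [Finset.sum_comm]
  refine Finset.sum_congr rfl fun b _ => ?_
  rw [← Equiv.sum_comp (Equiv.mulLeft b)]
  refine Finset.sum_congr rfl fun c _ => ?_
  simp [mul_assoc]

variable (k G) in
open Classical in
/-- The grading of `k` concentrated in degree `1`. -/
def unitProj (g : G) : k →ₗ[k] k := if g = 1 then LinearMap.id else 0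

theorem unitProj_one : unitProj k G 1 = LinearMap.id := by simp [unitProj]

theorem unitProj_ne {g : G} (h : g ≠ 1) : unitProj k G g = 0 := by simp [unitProj, h]

theorem tensorProj_lid [Fintype G] (p : G → V →ₗ[k] V) (g : G) :
    (TensorProduct.lid k V).toLinearMap ∘ₗ tensorProj (unitProj k G) p g =
      p g ∘ₗ (TensorProduct.lid k V).toLinearMap := by
  refine TensorProduct.ext' fun c x => ?_
  simp only [LinearMap.comp_apply, LinearEquiv.coe_coe]
  rw [tensorProj_tmul, Finset.sum_eq_single (1 : G)]
  · simp [unitProj_one]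
  · intro b _ hb
    simp [unitProj_ne hb]
  · simp

theorem tensorProj_rid [Fintype G] (p : G → V →ₗ[k] V) (g : G) :
    (TensorProduct.rid k V).toLinearMap ∘ₗ tensorProj p (unitProj k G) g =
      p g ∘ₗ (TensorProduct.rid k V).toLinearMap := by
  refine TensorProduct.ext' fun x c => ?_
  simp only [LinearMap.comp_apply, LinearEquiv.coe_coe]
  rw [tensorProj_tmul, Finset.sum_eq_single g]
  · simp [unitProj_one]
  · intro b _ hb
    have : b⁻¹ * g ≠ 1 := by simpa [inv_mul_eq_one] using hb
    simp [unitProj_ne this]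
  · simp

/-- The map `x ⊗ y ↦ f y ⊗ x` for `x` of degree `f`, where `p` is the grading of `V` and `ρ` the
action on `W`. -/
def braidMap [Fintype G] (p : G → V →ₗ[k] V) (ρ : Representation k G W) : V ⊗[k] W →ₗ[k] W ⊗[k] V :=
  ∑ f, TensorProduct.map (ρ f) (p f) ∘ₗ (TensorProduct.comm k V W).toLinearMap

theorem braidMap_tmul [Fintype G] (p : G → V →ₗ[k] V) (ρ : Representation k G W) (x : V) (y : W) :
    braidMap p ρ (x ⊗ₜ[k] y) = ∑ f, ρ f y ⊗ₜ[k] p f x := by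
  simp [braidMap, LinearMap.sum_apply]

end Raw

/-- An object of `Z(G)`: a finite-dimensional `G`-graded vector space `V = ⨁ g, V_g` with a
compatible `G`-action. The grading is given by the projections `proj g : V → V` onto the homogeneous
components (so `V_g` is the range of `proj g`), i.e. by a complete family of orthogonal idempotents;
compatibility `f (V_g) = V_{f g f⁻¹}` is `act_proj`. -/
structure ZObj (k G : Type u) [Field k] [Group G] [Fintype G] where
  V : Type u
  [addCommGroup : AddCommGroup V]
  [module : Module k V]
  [finiteDimensional : FiniteDimensional k V]
  proj : G → V →ₗ[k] V
  act : Representation k G V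
  proj_self : ∀ g v, proj g (proj g v) = proj g v
  proj_of_ne : ∀ g h v, g ≠ h → proj g (proj h v) = 0
  sum_proj : ∀ v, ∑ g, proj g v = v
  act_proj : ∀ f g v, act f (proj g v) = proj (f * g * f⁻¹) (act f v)

attribute [instance] ZObj.addCommGroup ZObj.module ZObj.finiteDimensional

namespace ZObj

variable {k G : Type u} [Field k] [Group G] [Fintype G]

/-- The homogeneous component `X_g`. -/
def component (X : ZObj k G) (g : G) : Submodule k X.V := LinearMap.range (X.proj g)

theorem mem_component {X : ZObj k G} {g : G} {v : X.V} : v ∈ X.component g ↔ X.proj g v = v := by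
  constructor
  · rintro ⟨w, rfl⟩; exact X.proj_self g w
  · intro h; exact ⟨v, h⟩

open Classical in
theorem proj_proj (X : ZObj k G) (g h : G) (v : X.V) :
    X.proj g (X.proj h v) = if g = h then X.proj g v else 0 := by
  split_ifs with e
  · subst e; exact X.proj_self _ _
  · exact X.proj_of_ne _ _ _ e

/-- The components do form a direct sum decomposition. -/
theorem isInternal_component (X : ZObj k G) [DecidableEq G] :
    DirectSum.IsInternal X.component := by
  rw [DirectSum.isInternal_submodule_iff_iSupIndep_and_iSup_eq_top]
  constructor
  · rw [iSupIndep_def]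
    intro g
    rw [Submodule.disjoint_def]
    intro v hv hv'
    have hle : (⨆ j, ⨆ (_ : j ≠ g), X.component j) ≤ LinearMap.ker (X.proj g) := by
      refine iSup₂_le fun j hj => ?_
      rintro _ ⟨w, rfl⟩
      exact X.proj_of_ne _ _ _ hj.symm
    rw [← mem_component.1 hv]
    exact hle hv'
  · rw [eq_top_iff]
    intro v _
    rw [← X.sum_proj v]
    exact Submodule.sum_mem _ fun g _ => (le_iSup X.component g) ⟨v, rfl⟩

/-- A morphism of `Z(G)`: a linear map preserving the grading and the action. -/
@[ext]
structure Hom (X Y : ZObj k G) where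
  lin : X.V →ₗ[k] Y.V
  lin_proj : ∀ g v, lin (X.proj g v) = Y.proj g (lin v)
  lin_act : ∀ g v, lin (X.act g v) = Y.act g (lin v)

instance : Category (ZObj k G) where
  Hom X Y := Hom X Y
  id X := ⟨LinearMap.id, fun _ _ => rfl, fun _ _ => rfl⟩
  comp f g := ⟨g.lin ∘ₗ f.lin, fun a v => by simp [f.lin_proj, g.lin_proj],
    fun a v => by simp [f.lin_act, g.lin_act]⟩

theorem hom_ext {X Y : ZObj k G} {f g : X ⟶ Y} (h : f.lin = g.lin) : f = g := Hom.ext h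

@[simp] theorem lin_id (X : ZObj k G) : Hom.lin (𝟙 X) = LinearMap.id := rfl

@[simp] theorem lin_comp {X Y Z : ZObj k G} (f : X ⟶ Y) (g : Y ⟶ Z) :
    Hom.lin (f ≫ g) = g.lin ∘ₗ f.lin := rfl

/-- An isomorphism of `Z(G)` from a linear equivalence preserving the grading and the action. -/
def mkIso {X Y : ZObj k G} (e : X.V ≃ₗ[k] Y.V) (hp : ∀ g v, e (X.proj g v) = Y.proj g (e v))
    (ha : ∀ g v, e (X.act g v) = Y.act g (e v)) : X ≅ Y where
  hom := ⟨e.toLinearMap, hp, ha⟩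
  inv := ⟨e.symm.toLinearMap, fun g v => by simp [LinearEquiv.symm_apply_eq, hp],
    fun g v => by simp [LinearEquiv.symm_apply_eq, ha]⟩
  hom_inv_id := hom_ext (by ext; simp)
  inv_hom_id := hom_ext (by ext; simp)

/-- The tensor product: `(X ⊗ Y)_g = ⨁_{ab = g} X_a ⊗ Y_b`, with `f (x ⊗ y) = f x ⊗ f y`. -/
def tensor (X Y : ZObj k G) : ZObj k G where
  V := X.V ⊗[k] Y.V
  proj := tensorProj X.proj Y.proj
  act := X.act.tprod Y.act
  proj_self g v := by
    classical
    induction v using TensorProduct.induction_on with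
    | zero => simp
    | add x y hx hy => rw [map_add, map_add, hx, hy]
    | tmul x y => simp [tensorProj_tmul, proj_proj, TensorProduct.ite_tmul]
  proj_of_ne g h v hgh := by
    classical
    induction v using TensorProduct.induction_on with
    | zero => simp
    | add x y hx hy => rw [map_add, map_add, hx, hy, add_zero]
    | tmul x y =>
      simp [tensorProj_tmul, proj_proj, TensorProduct.ite_tmul, hgh]
  sum_proj v := by
    induction v using TensorProduct.induction_on with
    | zero => simp
    | add x y hx hy => simp only [map_add, Finset.sum_add_distrib, hx, hy]
    | tmul x y =>
      simp only [tensorProj_tmul]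
      rw [Finset.sum_comm]
      have : ∀ a : G, ∑ g, X.proj a x ⊗ₜ[k] Y.proj (a⁻¹ * g) y = X.proj a x ⊗ₜ[k] y := by
        intro a
        rw [← TensorProduct.tmul_sum]
        congr 1
        exact (Equiv.sum_comp (Equiv.mulLeft a⁻¹) fun g => Y.proj g y).trans (Y.sum_proj y)
      simp only [this, ← TensorProduct.sum_tmul, X.sum_proj]
  act_proj f g v := by
    induction v using TensorProduct.induction_on with
    | zero => simp
    | add x y hx hy => simp only [map_add, hx, hy]
    | tmul x y =>
      simp only [tensorProj_tmul, map_sum, Representation.tprod_apply, TensorProduct.map_tmul,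
        act_proj]
      rw [← Equiv.sum_comp (MulAut.conj f).toEquiv
        (fun a => X.proj a (X.act f x) ⊗ₜ[k] Y.proj (a⁻¹ * (f * g * f⁻¹)) (Y.act f y))]
      refine Finset.sum_congr rfl fun a _ => ?_
      simp [mul_assoc]

/-- The unit object: `k` in degree `1`, with the trivial action. -/
def unit : ZObj k G where
  V := k
  proj := unitProj k G
  act := Representation.trivial k G k
  proj_self g v := by
    by_cases h : g = 1
    · subst h; simp [unitProj_one]
    · simp [unitProj_ne h]
  proj_of_ne g h v hgh := by
    by_cases h1 : h = 1
    · subst h1; simp [unitProj_ne hgh]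
    · simp [unitProj_ne h1]
  sum_proj v := by
    rw [Finset.sum_eq_single (1 : G)]
    · simp [unitProj_one]
    · intro b _ hb; simp [unitProj_ne hb]
    · simp
  act_proj f g v := by
    by_cases h1 : g = 1
    · simp [h1]
    · have : f * g * f⁻¹ ≠ 1 := by simpa using h1
      simp [unitProj_ne h1, unitProj_ne this]

/-- The tensor product of morphisms. -/
def tensorMap {X X' Y Y' : ZObj k G} (f : X ⟶ X') (g : Y ⟶ Y') : tensor X Y ⟶ tensor X' Y' where
  lin := TensorProduct.map f.lin g.lin
  lin_proj a := LinearMap.congr_fun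
    (tensorProj_map X.proj Y.proj X'.proj Y'.proj f.lin g.lin f.lin_proj g.lin_proj a)
  lin_act a := LinearMap.congr_fun
    (f := TensorProduct.map f.lin g.lin ∘ₗ X.act.tprod Y.act a)
    (g := X'.act.tprod Y'.act a ∘ₗ TensorProduct.map f.lin g.lin)
    (TensorProduct.ext' fun x y => by simp [f.lin_act, g.lin_act])

/-- The associativity isomorphism `(x ⊗ y) ⊗ z ↦ x ⊗ (y ⊗ z)`. -/
def assoc (X Y Z : ZObj k G) : tensor (tensor X Y) Z ≅ tensor X (tensor Y Z) :=
  mkIso (X := tensor (tensor X Y) Z) (Y := tensor X (tensor Y Z))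
    (TensorProduct.assoc k X.V Y.V Z.V)
    (fun g => LinearMap.congr_fun (tensorProj_assoc X.proj Y.proj Z.proj g))
    (fun g => LinearMap.congr_fun
      (f := (TensorProduct.assoc k X.V Y.V Z.V).toLinearMap ∘ₗ (X.act.tprod Y.act).tprod Z.act g)
      (g := X.act.tprod (Y.act.tprod Z.act) g ∘ₗ (TensorProduct.assoc k X.V Y.V Z.V).toLinearMap)
      (TensorProduct.ext_threefold fun _ _ _ => rfl))

/-- The left unit isomorphism `c ⊗ x ↦ c • x`. -/
def leftUnitor (X : ZObj k G) : tensor unit X ≅ X :=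
  mkIso (X := tensor unit X) (TensorProduct.lid k X.V)
    (fun g => LinearMap.congr_fun (tensorProj_lid X.proj g))
    (fun g => LinearMap.congr_fun
      (f := (TensorProduct.lid k X.V).toLinearMap ∘ₗ (Representation.trivial k G k).tprod X.act g)
      (g := X.act g ∘ₗ (TensorProduct.lid k X.V).toLinearMap)
      (TensorProduct.ext' fun c x => by simp))

/-- The right unit isomorphism `x ⊗ c ↦ c • x`. -/
def rightUnitor (X : ZObj k G) : tensor X unit ≅ X :=
  mkIso (X := tensor X unit) (TensorProduct.rid k X.V)
    (fun g => LinearMap.congr_fun (tensorProj_rid X.proj g))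
    (fun g => LinearMap.congr_fun
      (f := (TensorProduct.rid k X.V).toLinearMap ∘ₗ X.act.tprod (Representation.trivial k G k) g)
      (g := X.act g ∘ₗ (TensorProduct.rid k X.V).toLinearMap)
      (TensorProduct.ext' fun c x => by simp))

instance : MonoidalCategoryStruct (ZObj k G) where
  tensorObj := tensor
  tensorHom := tensorMap
  whiskerLeft X _ _ f := tensorMap (𝟙 X) f
  whiskerRight f Y := tensorMap f (𝟙 Y)
  tensorUnit := unit
  associator := assoc
  leftUnitor := leftUnitor
  rightUnitor := rightUnitor

theorem triangle_aux (V W : Type u) [AddCommGroup V] [Module k V] [AddCommGroup W] [Module k W] :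
    TensorProduct.map LinearMap.id (TensorProduct.lid k W).toLinearMap ∘ₗ
      (TensorProduct.assoc k V k W).toLinearMap =
    TensorProduct.map (TensorProduct.rid k V).toLinearMap (LinearMap.id : W →ₗ[k] W) :=
  TensorProduct.ext_threefold fun x c y => by simp [TensorProduct.smul_tmul]

theorem lid_naturality {V W : Type u} [AddCommGroup V] [Module k V] [AddCommGroup W] [Module k W]
    (f : V →ₗ[k] W) : (TensorProduct.lid k W).toLinearMap ∘ₗ TensorProduct.map LinearMap.id f =
      f ∘ₗ (TensorProduct.lid k V).toLinearMap :=
  TensorProduct.ext' fun c x => by simp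

theorem rid_naturality {V W : Type u} [AddCommGroup V] [Module k V] [AddCommGroup W] [Module k W]
    (f : V →ₗ[k] W) : (TensorProduct.rid k W).toLinearMap ∘ₗ TensorProduct.map f LinearMap.id =
      f ∘ₗ (TensorProduct.rid k V).toLinearMap :=
  TensorProduct.ext' fun c x => by simp

instance : MonoidalCategory (ZObj k G) := MonoidalCategory.ofTensorHom
  (id_tensorHom_id := fun _ _ => hom_ext (TensorProduct.ext' fun _ _ => rfl))
  (id_tensorHom := fun _ _ _ _ => rfl)
  (tensorHom_id := fun _ _ => rfl)
  (tensorHom_comp_tensorHom := fun _ _ _ _ => hom_ext (TensorProduct.ext' fun _ _ => rfl))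
  (associator_naturality := fun _ _ _ => hom_ext (TensorProduct.ext_threefold fun _ _ _ => rfl))
  (leftUnitor_naturality := fun f => hom_ext (lid_naturality f.lin))
  (rightUnitor_naturality := fun f => hom_ext (rid_naturality f.lin))
  (pentagon := fun _ _ _ _ => hom_ext (TensorProduct.ext (TensorProduct.ext_threefold
    fun _ _ _ => LinearMap.ext fun _ => rfl)))
  (triangle := fun X Y => hom_ext (triangle_aux X.V Y.V))

theorem braidMap_proj (X Y : ZObj k G) (g : G) :
    braidMap X.proj Y.act ∘ₗ tensorProj X.proj Y.proj g =
      tensorProj Y.proj X.proj g ∘ₗ braidMap X.proj Y.act := by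
  classical
  refine TensorProduct.ext' fun x y => ?_
  simp only [LinearMap.comp_apply, tensorProj_tmul, braidMap_tmul, map_sum]
  rw [Finset.sum_comm]
  refine Finset.sum_congr rfl fun f _ => ?_
  rw [Finset.sum_eq_single f, Finset.sum_eq_single (g * f⁻¹)]
  · rw [act_proj, proj_self]
    simp [mul_assoc, proj_self]
  · intro b _ hb
    rw [proj_of_ne, TensorProduct.tmul_zero]
    rintro h
    exact hb (by rw [← h]; group)
  · simp
  · intro b _ hb
    rw [proj_of_ne _ _ _ _ hb.symm, TensorProduct.tmul_zero]
  · simp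

theorem braidMap_act (X Y : ZObj k G) (g : G) :
    braidMap X.proj Y.act ∘ₗ X.act.tprod Y.act g =
      Y.act.tprod X.act g ∘ₗ braidMap X.proj Y.act := by
  refine TensorProduct.ext' fun x y => ?_
  simp only [LinearMap.comp_apply, Representation.tprod_apply, TensorProduct.map_tmul,
    braidMap_tmul, map_sum]
  rw [← Equiv.sum_comp (MulAut.conj g).toEquiv]
  refine Finset.sum_congr rfl fun f _ => ?_
  simp only [act_proj, MulEquiv.toEquiv_eq_coe, MulEquiv.coe_toEquiv, MulAut.conj_apply,
    ← Module.End.mul_apply, ← map_mul]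
  simp [act_proj]

/-- The inverse braiding `y ⊗ x ↦ x ⊗ f⁻¹ y` for `x` of degree `f`. -/
def braidInv (X Y : ZObj k G) : Y.V ⊗[k] X.V →ₗ[k] X.V ⊗[k] Y.V :=
  ∑ f, TensorProduct.map (X.proj f) (Y.act f⁻¹) ∘ₗ (TensorProduct.comm k Y.V X.V).toLinearMap

theorem braidInv_tmul (X Y : ZObj k G) (x : X.V) (y : Y.V) :
    braidInv X Y (y ⊗ₜ[k] x) = ∑ f, X.proj f x ⊗ₜ[k] Y.act f⁻¹ y := by
  simp [braidInv, LinearMap.sum_apply]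

theorem act_inv_act (X : ZObj k G) (f : G) (x : X.V) : X.act f⁻¹ (X.act f x) = x := by
  rw [← Module.End.mul_apply, ← map_mul]; simp

theorem act_act_inv (X : ZObj k G) (f : G) (x : X.V) : X.act f (X.act f⁻¹ x) = x := by
  rw [← Module.End.mul_apply, ← map_mul]; simp

theorem braidInv_comp (X Y : ZObj k G) :
    braidInv X Y ∘ₗ braidMap X.proj Y.act = LinearMap.id := by
  classical
  refine TensorProduct.ext' fun x y => ?_
  simp only [LinearMap.comp_apply, braidMap_tmul, braidInv_tmul, map_sum, LinearMap.id_apply,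
    proj_proj, TensorProduct.ite_tmul, Finset.sum_ite_eq', Finset.mem_univ, if_true,
    Finset.sum_ite_eq, act_inv_act, ← TensorProduct.sum_tmul, sum_proj]

theorem comp_braidInv (X Y : ZObj k G) :
    braidMap X.proj Y.act ∘ₗ braidInv X Y = LinearMap.id := by
  classical
  refine TensorProduct.ext' fun y x => ?_
  simp only [LinearMap.comp_apply, braidMap_tmul, braidInv_tmul, map_sum, LinearMap.id_apply,
    proj_proj, TensorProduct.tmul_ite, Finset.sum_ite_eq', Finset.mem_univ, if_true,
    Finset.sum_ite_eq, act_act_inv, ← TensorProduct.tmul_sum, sum_proj]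

/-- The braiding `x ⊗ y ↦ f y ⊗ x` for `x ∈ X_f`. -/
def braid (X Y : ZObj k G) : tensor X Y ≅ tensor Y X :=
  mkIso (X := tensor X Y) (Y := tensor Y X)
    (LinearEquiv.ofLinearMap (braidMap X.proj Y.act) (braidInv X Y) (comp_braidInv X Y)
      (braidInv_comp X Y))
    (fun g => LinearMap.congr_fun (braidMap_proj X Y g))
    (fun g => LinearMap.congr_fun (braidMap_act X Y g))

theorem braidMap_natural {X X' Y Y' : ZObj k G} (f : X ⟶ X') (g : Y ⟶ Y') :
    braidMap X'.proj Y'.act ∘ₗ TensorProduct.map f.lin g.lin =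
      TensorProduct.map g.lin f.lin ∘ₗ braidMap X.proj Y.act := by
  refine TensorProduct.ext' fun x y => ?_
  simp [braidMap_tmul, f.lin_proj, g.lin_act]

theorem hexagon_forward_aux (X Y Z : ZObj k G) :
    (TensorProduct.assoc k Y.V Z.V X.V).toLinearMap ∘ₗ braidMap X.proj (Y.act.tprod Z.act) ∘ₗ
        (TensorProduct.assoc k X.V Y.V Z.V).toLinearMap =
      TensorProduct.map LinearMap.id (braidMap X.proj Z.act) ∘ₗ
        (TensorProduct.assoc k Y.V X.V Z.V).toLinearMap ∘ₗ
        TensorProduct.map (braidMap X.proj Y.act) LinearMap.id := by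
  classical
  refine TensorProduct.ext_threefold fun x y z => ?_
  simp only [LinearMap.comp_apply, LinearEquiv.coe_coe, TensorProduct.assoc_tmul, braidMap_tmul,
    TensorProduct.map_tmul, map_sum, TensorProduct.sum_tmul, TensorProduct.tmul_sum,
    Representation.tprod_apply, LinearMap.id_apply, proj_proj, TensorProduct.tmul_ite,
    TensorProduct.tmul_zero, Finset.sum_ite_eq', Finset.sum_ite_eq, Finset.mem_univ, if_true]

theorem hexagon_reverse_aux (X Y Z : ZObj k G) :
    (TensorProduct.assoc k Z.V X.V Y.V).symm.toLinearMap ∘ₗ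
        braidMap (tensorProj X.proj Y.proj) Z.act ∘ₗ
        (TensorProduct.assoc k X.V Y.V Z.V).symm.toLinearMap =
      TensorProduct.map (braidMap X.proj Z.act) LinearMap.id ∘ₗ
        (TensorProduct.assoc k X.V Z.V Y.V).symm.toLinearMap ∘ₗ
        TensorProduct.map LinearMap.id (braidMap Y.proj Z.act) := by
  refine TensorProduct.ext_threefold' fun x y z => ?_
  simp only [LinearMap.comp_apply, LinearEquiv.coe_coe, TensorProduct.assoc_symm_tmul,
    braidMap_tmul, TensorProduct.map_tmul, map_sum, TensorProduct.sum_tmul, TensorProduct.tmul_sum,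
    LinearMap.id_apply, tensorProj_tmul]
  rw [Finset.sum_comm]
  conv_rhs => rw [Finset.sum_comm]
  refine Finset.sum_congr rfl fun a _ => ?_
  rw [← Equiv.sum_comp (Equiv.mulLeft a)]
  refine Finset.sum_congr rfl fun c _ => ?_
  simp

instance : BraidedCategory (ZObj k G) where
  braiding := braid
  braiding_naturality_right X _ _ f := hom_ext (braidMap_natural (𝟙 X) f)
  braiding_naturality_left f Z := hom_ext (braidMap_natural f (𝟙 Z))
  hexagon_forward X Y Z := hom_ext (hexagon_forward_aux X Y Z)
  hexagon_reverse X Y Z := hom_ext (hexagon_reverse_aux X Y Z)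

end ZObj

/-- Conjugation `f ↦ h f h⁻¹` of a normal subgroup `F` of `H` by an element of `H`. -/
def conjOn {G : Type u} [Group G] {H F : Subgroup G} (hF : F ≤ H) (hn : (F.subgroupOf H).Normal)
    (h : H) (f : F) : F :=
  ⟨h * f * (h : G)⁻¹, Subgroup.mem_subgroupOf.1
    (hn.conj_mem ⟨f, hF f.2⟩ (Subgroup.mem_subgroupOf.2 f.2) h)⟩

/-- A quadruple `(H, F, γ, ε)`: a subgroup `H` of `G`, a normal subgroup `F` of `H`, a normalised
2-cocycle `γ` on `F` with values in `kˣ` and a map `ε : H × F → kˣ` satisfying the three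
compatibility identities. -/
structure Quadruple (k G : Type u) [Field k] [Group G] where
  H : Subgroup G
  F : Subgroup G
  F_le : F ≤ H
  normal : (F.subgroupOf H).Normal
  γ : F → F → kˣ
  γ_one_left : ∀ f, γ 1 f = 1
  γ_one_right : ∀ f, γ f 1 = 1
  γ_cocycle : ∀ f g h, γ f g * γ (f * g) h = γ g h * γ f (g * h)
  ε : H → F → kˣ
  eps1 : ∀ (g h : H) (f : F), ε (g * h) f = ε g (conjOn F_le normal h f) * ε h f
  eps2 : ∀ (h : H) (f g : F), γ f g * ε h (f * g) =
    ε h f * ε h g * γ (conjOn F_le normal h f) (conjOn F_le normal h g)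
  eps3 : ∀ f g : F, γ f g =
    ε ⟨f, F_le f.2⟩ g * γ (conjOn F_le normal ⟨f, F_le f.2⟩ g) f

namespace Quadruple

variable {k G : Type u} [Field k] [Group G] (Q : Quadruple k G)

/-- `h f h⁻¹` for `h ∈ H`, `f ∈ F`. -/
abbrev conj (h : Q.H) (f : Q.F) : Q.F := conjOn Q.F_le Q.normal h f

theorem conj_mul (h : Q.H) (f g : Q.F) : Q.conj h (f * g) = Q.conj h f * Q.conj h g :=
  Subtype.ext (by simp [conjOn])

theorem conj_one (h : Q.H) : Q.conj h 1 = 1 := Subtype.ext (by simp [conjOn])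

theorem mul_conj (g h : Q.H) (f : Q.F) : Q.conj (g * h) f = Q.conj g (Q.conj h f) :=
  Subtype.ext (by simp [conjOn, mul_assoc])

theorem one_conj (f : Q.F) : Q.conj 1 f = f := Subtype.ext (by simp [conjOn])

theorem ε_one_right (h : Q.H) : Q.ε h 1 = 1 := by
  have := Q.eps2 h 1 1
  simpa [conj_one, Q.γ_one_left] using this

theorem ε_one_left (f : Q.F) : Q.ε 1 f = 1 := by
  have := Q.eps1 1 1 f
  simpa [one_conj] using this

/-- The span of the relations `a_{gh,f} = ε_h(f) a_{g,hfh⁻¹}` in the vector space with basis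
`a_{g,f}`, `g ∈ G`, `f ∈ F`. -/
def rel : Submodule k (G × Q.F →₀ k) :=
  Submodule.span k (Set.range fun t : G × Q.H × Q.F =>
    Finsupp.single (t.1 * t.2.1, t.2.2) 1 -
      (Q.ε t.2.1 t.2.2 : k) • Finsupp.single (t.1, Q.conj t.2.1 t.2.2) 1)

/-- The vector space spanned by `a_{g,f}`, `g ∈ G`, `f ∈ F`, modulo the relations. -/
abbrev Carrier : Type u := (G × Q.F →₀ k) ⧸ Q.rel

/-- The element `a_{g,f}`. -/
def gen (g : G) (f : Q.F) : Q.Carrier := Q.rel.mkQ (Finsupp.single (g, f) 1)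

theorem gen_mul (g : G) (h : Q.H) (f : Q.F) :
    Q.gen (g * h) f = (Q.ε h f : k) • Q.gen g (Q.conj h f) := by
  rw [gen, gen, ← map_smul, ← sub_eq_zero, ← map_sub, Submodule.mkQ_apply,
    Submodule.Quotient.mk_eq_zero]
  exact Submodule.subset_span ⟨(g, h, f), rfl⟩

theorem ext {W : Type u} [AddCommGroup W] [Module k W] {φ ψ : Q.Carrier →ₗ[k] W} (h : ∀ g f, φ (Q.gen g f) = ψ (Q.gen g f)) : φ = ψ := by
  refine Submodule.linearMap_qext _ (Finsupp.lhom_ext' fun t => LinearMap.ext_ring ?_)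
  exact h t.1 t.2

/-- The linear map sending `a_{g,f}` to `φ g f`. -/
def lift {W : Type u} [AddCommGroup W] [Module k W] (φ : G → Q.F → W)
    (hφ : ∀ g (h : Q.H) f, φ (g * h) f = (Q.ε h f : k) • φ g (Q.conj h f)) :
    Q.Carrier →ₗ[k] W :=
  Q.rel.liftQ (Finsupp.linearCombination k fun t : G × Q.F => φ t.1 t.2) (by
    rw [rel, Submodule.span_le]
    rintro _ ⟨⟨g, h, f⟩, rfl⟩
    simp [hφ])

@[simp] theorem lift_gen {W : Type u} [AddCommGroup W] [Module k W] (φ : G → Q.F → W)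
    (hφ : ∀ g (h : Q.H) f, φ (g * h) f = (Q.ε h f : k) • φ g (Q.conj h f)) (g : G) (f : Q.F) :
    Q.lift φ hφ (Q.gen g f) = φ g f := by
  simp [lift, gen]

/-- The degree of `a_{g,f}` is `g f g⁻¹`. -/
def degree (g : G) (f : Q.F) : G := g * f * g⁻¹

theorem degree_mul (g : G) (h : Q.H) (f : Q.F) :
    Q.degree (g * h) f = Q.degree g (Q.conj h f) := by
  simp [degree, conjOn, mul_assoc]

open Classical in
/-- The projection onto the component of degree `x`. -/
def proj (x : G) : Q.Carrier →ₗ[k] Q.Carrier :=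
  Q.lift (fun g f => if Q.degree g f = x then Q.gen g f else 0) (fun g h f => by
    rw [degree_mul]; split_ifs <;> simp [gen_mul])

open Classical in
theorem proj_gen (x g : G) (f : Q.F) :
    Q.proj x (Q.gen g f) = if Q.degree g f = x then Q.gen g f else 0 := by
  simp [proj]

/-- The action of `x` sends `a_{g,f}` to `a_{xg,f}`. -/
def act : Representation k G Q.Carrier where
  toFun x := Q.lift (fun g f => Q.gen (x * g) f) (fun g h f => by rw [← mul_assoc, gen_mul])
  map_one' := Q.ext fun g f => by simp
  map_mul' x y := Q.ext fun g f => by simp [mul_assoc]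

@[simp] theorem act_gen (x g : G) (f : Q.F) : Q.act x (Q.gen g f) = Q.gen (x * g) f := by
  simp [act]

/-- The underlying object of the algebra `A(H, F, γ, ε)`. -/
def obj [Fintype G] : ZObj k G where
  V := Q.Carrier
  proj := Q.proj
  act := Q.act
  proj_self x := LinearMap.congr_fun (f := Q.proj x ∘ₗ Q.proj x) (Q.ext fun g f => by
    simp only [LinearMap.comp_apply, proj_gen]
    split_ifs with h <;> simp [proj_gen, h])
  proj_of_ne x y v hxy := by
    have : Q.proj x ∘ₗ Q.proj y = 0 := Q.ext fun g f => by
      simp only [LinearMap.comp_apply, proj_gen]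
      split_ifs with h
      · simp [proj_gen, h, hxy.symm]
      · simp
    exact LinearMap.congr_fun this v
  sum_proj v := by
    classical
    have : ∑ x, Q.proj x = LinearMap.id := Q.ext fun g f => by
      simp [LinearMap.sum_apply, proj_gen]
    simpa [LinearMap.sum_apply] using LinearMap.congr_fun this v
  act_proj x y v := by
    have : Q.act x ∘ₗ Q.proj y = Q.proj (x * y * x⁻¹) ∘ₗ Q.act x := Q.ext fun g f => by
      have hd : Q.degree (x * g) f = x * Q.degree g f * x⁻¹ := by simp [degree, mul_assoc]
      simp only [LinearMap.comp_apply, proj_gen]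
      by_cases h : Q.degree g f = y
      · rw [if_pos h, act_gen, proj_gen, if_pos (by rw [hd, h])]
      · rw [if_neg h, act_gen, proj_gen, if_neg (by simpa [hd] using h), map_zero]
    exact LinearMap.congr_fun this v

open Classical in
/-- The product `a_{g,f} a_{g',f'}`. It vanishes if the cosets `gH` and `g'H` differ; if `g' = g h`
with `h ∈ H`, then `a_{g',f'} = ε_h(f') a_{g,hf'h⁻¹}` and the product is determined by
`a_{g,f} a_{g,f'} = γ(f,f') a_{g,ff'}`. -/
def genMul (g : G) (f : Q.F) (g' : G) (f' : Q.F) : Q.Carrier :=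
  if h : g⁻¹ * g' ∈ Q.H then
    ((Q.ε ⟨_, h⟩ f' * Q.γ f (Q.conj ⟨_, h⟩ f') : kˣ) : k) • Q.gen g (f * Q.conj ⟨_, h⟩ f')
  else 0

theorem genMul_mul (g : G) (f : Q.F) (h : Q.H) (f' : Q.F) : Q.genMul g f (g * h) f' =
    ((Q.ε h f' * Q.γ f (Q.conj h f') : kˣ) : k) • Q.gen g (f * Q.conj h f') := by
  have h1 : g⁻¹ * (g * h) ∈ Q.H := by simp
  have h2 : (⟨g⁻¹ * (g * h), h1⟩ : Q.H) = h := Subtype.ext (by simp)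
  rw [genMul, dif_pos h1, h2]

theorem genMul_of_notMem {g g' : G} (h : g⁻¹ * g' ∉ Q.H) (f f' : Q.F) :
    Q.genMul g f g' f' = 0 := dif_neg h

theorem genMul_right (g : G) (f : Q.F) (g' : G) (h : Q.H) (f' : Q.F) :
    Q.genMul g f (g' * h) f' = (Q.ε h f' : k) • Q.genMul g f g' (Q.conj h f') := by
  by_cases hg : g⁻¹ * g' ∈ Q.H
  · obtain ⟨u, rfl⟩ : ∃ u : Q.H, g' = g * u := ⟨⟨_, hg⟩, by simp⟩
    rw [mul_assoc, ← Subgroup.coe_mul, genMul_mul, genMul_mul, smul_smul, mul_conj, Q.eps1]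
    congr 1
    push_cast; ring
  · rw [genMul_of_notMem _ hg, genMul_of_notMem, smul_zero]
    rwa [← mul_assoc, Subgroup.mul_mem_cancel_right _ h.2]

theorem genMul_left (g : G) (h : Q.H) (f : Q.F) (g' : G) (f' : Q.F) :
    Q.genMul (g * h) f g' f' = (Q.ε h f : k) • Q.genMul g (Q.conj h f) g' f' := by
  by_cases hg : g⁻¹ * g' ∈ Q.H
  · obtain ⟨u, rfl⟩ : ∃ u : Q.H, g' = g * h * u :=
      ⟨h⁻¹ * ⟨_, hg⟩, by simp [mul_assoc]⟩
    rw [genMul_mul, mul_assoc, ← Subgroup.coe_mul, genMul_mul, smul_smul, mul_conj, gen_mul,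
      smul_smul, conj_mul, Q.eps1]
    congr 1
    have := congrArg (Units.val) (Q.eps2 h f (Q.conj u f'))
    push_cast at this ⊢
    linear_combination (Q.ε u f' : k) * this
  · rw [genMul_of_notMem _ hg, genMul_of_notMem, smul_zero]
    rwa [mul_inv_rev, mul_assoc, ← Subgroup.coe_inv, Subgroup.mul_mem_cancel_left _ (h⁻¹).2]

/-- The multiplication of `A(H, F, γ, ε)`. -/
def mul : Q.Carrier →ₗ[k] Q.Carrier →ₗ[k] Q.Carrier :=
  Q.lift (fun g f => Q.lift (Q.genMul g f) (Q.genMul_right g f)) (fun g h f => Q.ext fun g' f' => by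
    simp [genMul_left])

theorem mul_gen (g : G) (f : Q.F) (g' : G) (f' : Q.F) :
    Q.mul (Q.gen g f) (Q.gen g' f') = Q.genMul g f g' f' := by
  simp [mul]

theorem mul_gen_same (g : G) (f f' : Q.F) :
    Q.mul (Q.gen g f) (Q.gen g f') = (Q.γ f f' : k) • Q.gen g (f * f') := by
  rw [mul_gen]
  simpa [ε_one_left, one_conj] using Q.genMul_mul g f 1 f'

theorem mul_gen_of_notMem {g g' : G} (h : g⁻¹ * g' ∉ Q.H) (f f' : Q.F) :
    Q.mul (Q.gen g f) (Q.gen g' f') = 0 := by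
  rw [mul_gen, genMul_of_notMem _ h]

theorem notMem_symm {g g' : G} (h : g⁻¹ * g' ∉ Q.H) : g'⁻¹ * g ∉ Q.H := fun h' => h (by
  simpa using inv_mem h')

theorem exists_gen_eq {g g' : G} (h : g⁻¹ * g' ∈ Q.H) (f : Q.F) :
    ∃ (c : k) (f' : Q.F), Q.gen g' f = c • Q.gen g f' := by
  have := Q.gen_mul g ⟨_, h⟩ f
  rw [mul_inv_cancel_left] at this
  exact ⟨_, _, this⟩

theorem mul_assoc_gen (g : G) (f : Q.F) (g' : G) (f' : Q.F) (g'' : G) (f'' : Q.F) :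
    Q.mul (Q.mul (Q.gen g f) (Q.gen g' f')) (Q.gen g'' f'') =
      Q.mul (Q.gen g f) (Q.mul (Q.gen g' f') (Q.gen g'' f'')) := by
  by_cases h : g'⁻¹ * g ∈ Q.H
  · obtain ⟨c, e, he⟩ := Q.exists_gen_eq h f
    by_cases h' : g'⁻¹ * g'' ∈ Q.H
    · obtain ⟨c', e', he'⟩ := Q.exists_gen_eq h' f''
      rw [he, he']
      simp only [map_smul, LinearMap.smul_apply, mul_gen_same, smul_smul, _root_.mul_assoc]
      congr 1
      have := congrArg Units.val (Q.γ_cocycle e f' e')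
      push_cast at this
      linear_combination c * c' * this
    · rw [he]
      simp [mul_gen_same, mul_gen_of_notMem _ h']
  · rw [Q.mul_gen_of_notMem (Q.notMem_symm h)]
    by_cases h' : g'⁻¹ * g'' ∈ Q.H
    · obtain ⟨c', e', he'⟩ := Q.exists_gen_eq h' f''
      rw [he']
      simp [mul_gen_same, mul_gen_of_notMem _ (Q.notMem_symm h)]
    · simp [mul_gen_of_notMem _ h']

theorem mul_act_gen (x : G) (g : G) (f : Q.F) (g' : G) (f' : Q.F) :
    Q.mul (Q.act x (Q.gen g f)) (Q.act x (Q.gen g' f')) =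
      Q.act x (Q.mul (Q.gen g f) (Q.gen g' f')) := by
  simp only [act_gen]
  by_cases h : g⁻¹ * g' ∈ Q.H
  · obtain ⟨u, rfl⟩ : ∃ u : Q.H, g' = g * u := ⟨⟨_, h⟩, by simp⟩
    simp only [mul_gen, ← mul_assoc x, genMul_mul, map_smul, act_gen]
  · rw [mul_gen_of_notMem _ h, mul_gen_of_notMem, map_zero]
    simpa [mul_assoc] using h

theorem mul_proj_gen [Fintype G] (x : G) (g : G) (f : Q.F) (g' : G) (f' : Q.F) :
    ∑ a, Q.mul (Q.proj a (Q.gen g f)) (Q.proj (a⁻¹ * x) (Q.gen g' f')) =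
      Q.proj x (Q.mul (Q.gen g f) (Q.gen g' f')) := by
  classical
  rw [Finset.sum_eq_single (Q.degree g f)]
  · simp only [proj_gen, if_true]
    by_cases h : g⁻¹ * g' ∈ Q.H
    · obtain ⟨u, rfl⟩ : ∃ u : Q.H, g' = g * u := ⟨⟨_, h⟩, by simp⟩
      have hd : Q.degree g (f * Q.conj u f') = Q.degree g f * Q.degree (g * u) f' := by
        simp [degree, conjOn, mul_assoc]
      simp only [mul_gen, genMul_mul, map_smul, proj_gen, hd, eq_inv_mul_iff_mul_eq]
      split_ifs <;> simp [mul_gen, genMul_mul]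
    · rw [mul_gen_of_notMem _ h]
      split_ifs <;> simp [mul_gen_of_notMem _ h]
  · intro b _ hb
    simp [proj_gen, hb.symm]
  · simp

/-- The element `a_{g,1}`, which depends only on the coset `c = gH`. -/
def idem (c : G ⧸ Q.H) : Q.Carrier := Q.gen c.out 1

theorem idem_mk (g : G) : Q.idem (QuotientGroup.mk g) = Q.gen g 1 := by
  obtain ⟨h, hh⟩ := QuotientGroup.mk_out_eq_mul Q.H g
  rw [idem, hh, gen_mul, conj_one, ε_one_right, Units.val_one, one_smul]

open Classical in
/-- The unit `∑ a_{g,1}`, the sum over the cosets `gH`. -/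
def one [Fintype G] : Q.Carrier := ∑ c : G ⧸ Q.H, Q.idem c

theorem one_mul_gen [Fintype G] (g : G) (f : Q.F) : Q.mul Q.one (Q.gen g f) = Q.gen g f := by
  classical
  rw [one, map_sum, LinearMap.sum_apply, Finset.sum_eq_single (QuotientGroup.mk g)]
  · rw [idem_mk, mul_gen_same, Q.γ_one_left]; simp
  · intro c _ hc
    induction c using QuotientGroup.induction_on with
    | H x =>
      rw [idem_mk, mul_gen_of_notMem]
      intro h; exact hc (QuotientGroup.eq.2 h)
  · simp

theorem gen_mul_one [Fintype G] (g : G) (f : Q.F) : Q.mul (Q.gen g f) Q.one = Q.gen g f := by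
  classical
  rw [one, map_sum, Finset.sum_eq_single (QuotientGroup.mk g)]
  · rw [idem_mk, mul_gen_same, Q.γ_one_right]; simp
  · intro c _ hc
    induction c using QuotientGroup.induction_on with
    | H x =>
      rw [idem_mk, mul_gen_of_notMem]
      intro h; exact hc (QuotientGroup.eq.2 h).symm
  · simp

theorem act_one [Fintype G] (x : G) : Q.act x Q.one = Q.one := by
  classical
  rw [one, map_sum]
  rw [← Equiv.sum_comp (MulAction.toPerm x) (fun c : G ⧸ Q.H => Q.idem c)]
  refine Finset.sum_congr rfl fun c _ => ?_
  induction c using QuotientGroup.induction_on with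
  | H g =>
    rw [idem_mk, act_gen, MulAction.toPerm_apply]
    exact (Q.idem_mk (x * g)).symm

theorem proj_one [Fintype G] : Q.proj 1 Q.one = Q.one := by
  classical
  rw [one, map_sum]
  refine Finset.sum_congr rfl fun c _ => ?_
  simp [idem, proj_gen, degree]

/-- The multiplication as a morphism of `Z(G)`. -/
def mulHom [Fintype G] : ZObj.tensor Q.obj Q.obj ⟶ Q.obj where
  lin := TensorProduct.lift Q.mul
  lin_proj x := LinearMap.congr_fun
    (f := TensorProduct.lift Q.mul ∘ₗ tensorProj Q.proj Q.proj x)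
    (g := Q.proj x ∘ₗ TensorProduct.lift Q.mul)
    (TensorProduct.ext (Q.ext fun g f => Q.ext fun g' f' => by
      simpa [tensorProj_tmul] using Q.mul_proj_gen x g f g' f'))
  lin_act x := LinearMap.congr_fun
    (f := TensorProduct.lift Q.mul ∘ₗ Q.act.tprod Q.act x)
    (g := Q.act x ∘ₗ TensorProduct.lift Q.mul)
    (TensorProduct.ext (Q.ext fun g f => Q.ext fun g' f' => by
      simpa using Q.mul_act_gen x g f g' f'))

/-- The unit as a morphism of `Z(G)`. -/
def oneHom [Fintype G] : ZObj.unit ⟶ Q.obj where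
  lin := LinearMap.toSpanSingleton k Q.Carrier Q.one
  lin_proj x := LinearMap.congr_fun
    (f := LinearMap.toSpanSingleton k Q.Carrier Q.one ∘ₗ unitProj k G x)
    (g := Q.proj x ∘ₗ LinearMap.toSpanSingleton k Q.Carrier Q.one)
    (LinearMap.ext_ring (by
      by_cases h : x = 1
      · subst h; simp [unitProj_one, proj_one]
      · have := (Q.obj).proj_of_ne x 1 Q.one h
        rw [show (Q.obj).proj 1 Q.one = Q.one from Q.proj_one] at this
        simpa [unitProj_ne h] using (show Q.proj x Q.one = 0 from this).symm))
  lin_act x := LinearMap.congr_fun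
    (f := LinearMap.toSpanSingleton k Q.Carrier Q.one ∘ₗ Representation.trivial k G k x)
    (g := Q.act x ∘ₗ LinearMap.toSpanSingleton k Q.Carrier Q.one)
    (LinearMap.ext_ring (by simp [act_one]))

theorem one_mul_aux [Fintype G] : TensorProduct.lift Q.mul ∘ₗ
    TensorProduct.map (LinearMap.toSpanSingleton k Q.Carrier Q.one) LinearMap.id =
      (TensorProduct.lid k Q.Carrier).toLinearMap :=
  TensorProduct.ext (LinearMap.ext_ring (Q.ext fun g f => by simp [one_mul_gen]))

theorem mul_one_aux [Fintype G] : TensorProduct.lift Q.mul ∘ₗ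
    TensorProduct.map LinearMap.id (LinearMap.toSpanSingleton k Q.Carrier Q.one) =
      (TensorProduct.rid k Q.Carrier).toLinearMap :=
  TensorProduct.ext (Q.ext fun g f => LinearMap.ext_ring (by simp [gen_mul_one]))

theorem mul_assoc_aux : TensorProduct.lift Q.mul ∘ₗ
    TensorProduct.map (TensorProduct.lift Q.mul) LinearMap.id =
      TensorProduct.lift Q.mul ∘ₗ TensorProduct.map LinearMap.id (TensorProduct.lift Q.mul) ∘ₗ
        (TensorProduct.assoc k Q.Carrier Q.Carrier Q.Carrier).toLinearMap :=
  TensorProduct.ext (TensorProduct.ext (Q.ext fun g f => Q.ext fun g' f' => Q.ext fun g'' f'' => by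
    simpa using Q.mul_assoc_gen g f g' f' g'' f''))

/-- The algebra `A(H, F, γ, ε)` in `Z(G)`. -/
def algebra [Fintype G] : Mon (ZObj k G) where
  X := Q.obj
  mon :=
    { one := Q.oneHom
      mul := Q.mulHom
      one_mul := ZObj.hom_ext Q.one_mul_aux
      mul_one := ZObj.hom_ext Q.mul_one_aux
      mul_assoc := ZObj.hom_ext Q.mul_assoc_aux }

/-- Two quadruples are equivalent if some `x ∈ G` conjugates `H` to `H'` and `F` to `F'`, and, after
this identification, `(γ, ε)` and `(γ', ε')` differ by the coboundary of a cochain `c : F → kˣ`. -/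
def Equivalent (Q Q' : Quadruple k G) : Prop :=
  ∃ (x : G) (hH : ∀ h, h ∈ Q.H ↔ x * h * x⁻¹ ∈ Q'.H) (hF : ∀ f, f ∈ Q.F ↔ x * f * x⁻¹ ∈ Q'.F)
    (c : Q.F → kˣ),
    (∀ f g : Q.F, c (f * g) * Q.γ f g =
      Q'.γ ⟨x * f * x⁻¹, (hF f).1 f.2⟩ ⟨x * g * x⁻¹, (hF g).1 g.2⟩ * c f * c g) ∧
    (∀ (h : Q.H) (f : Q.F), Q.ε h f * c (Q.conj h f) =
      c f * Q'.ε ⟨x * h * x⁻¹, (hH h).1 h.2⟩ ⟨x * f * x⁻¹, (hF f).1 f.2⟩)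

end Quadruple

section Algebras

open MonObj

/-- An algebra `(A, μ, ι)` in a monoidal category is separable (special Frobenius) if there is a
morphism `ε : A → 1` such that the pairing `e = ε ∘ μ : A ⊗ A → 1` is non-degenerate, with inverse
copairing `κ : 1 → A ⊗ A`, and such that the comultiplication `Δ(a) = a · κ` of the resulting
Frobenius algebra satisfies `μ ∘ Δ = id`, i.e. `μ ∘ κ = ι`. -/
def IsSeparableAlgebra {C : Type*} [Category C] [MonoidalCategory C] (A : Mon C) : Prop :=
  ∃ (ε : A.X ⟶ 𝟙_ C) (κ : 𝟙_ C ⟶ A.X ⊗ A.X),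
    (ρ_ A.X).inv ≫ A.X ◁ κ ≫ (α_ A.X A.X A.X).inv ≫ (μ[A.X] ≫ ε) ▷ A.X ≫ (λ_ A.X).hom = 𝟙 A.X ∧
    (λ_ A.X).inv ≫ κ ▷ A.X ≫ (α_ A.X A.X A.X).hom ≫ A.X ◁ (μ[A.X] ≫ ε) ≫ (ρ_ A.X).hom = 𝟙 A.X ∧
    κ ≫ μ[A.X] = η[A.X]

variable {k G : Type u} [Field k] [Group G] [Fintype G]

/-- An algebra in `Z(G)` is indecomposable if it is non-zero and is not the direct sum of two
non-zero algebras in `Z(G)`. -/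
def IsIndecomposableAlgebra (A : Mon (ZObj k G)) : Prop :=
  Nontrivial A.X.V ∧ ∀ (B C : Mon (ZObj k G)) (p : A ⟶ B) (q : A ⟶ C),
    Function.Bijective (fun a : A.X.V => (p.hom.lin a, q.hom.lin a)) →
      Subsingleton B.X.V ∨ Subsingleton C.X.V

end Algebras

end

/-! In a commutative algebra `A` in `Z(G)` an element `a` of degree `x` satisfies `a b = x(b) a`, so
the degree-one component is central. The whole classification is read off from a primitive
idempotent `p` of that component.

From algebras to quadruples: the copairing of a separable algebra makes its degree-one component von
Neumann regular, and over an algebraically closed field this yields `p ≠ 0` with `p A_1 = k p`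
(`exists_regular`, `exists_isPrimitive`). The translates of `p` are equal or orthogonal to it. Their
sum over the orbit is an invariant central idempotent, hence `1` by indecomposability
(`sum_act_eq_one`). The invariant non-degenerate functional `t` makes every non-zero homogeneous
element of `p A` invertible there, so the homogeneous components of `p A` have dimension at most one
and their degrees form a subgroup `F`. Let `H` be the stabilizer of `p`. Choosing `u f` in `(p A)_f`
with `u 1 = p`, the structure constants of product and action are `γ` and `ε`. The axioms of a
quadruple are associativity, the laws of the action and braided commutativity. A recognition lemma
(`nonempty_algebra_iso`) then identifies `A` with `A(H,F,γ,ε)`.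

From quadruples to algebras: the functional picking out the coefficients of the `a_{g,1}` has
explicit dual bases. Indecomposability holds because the invariants of degree one are the scalars
(`exists_eq_smul_one`).

Isomorphisms: an isomorphism carries the primitive idempotent `a_{1,1}` to some `a'_{y,1}`.
Comparing stabilizers, degrees and structure constants gives the conjugating element `x = y⁻¹` and
the cochain `c`. Conversely, `c` and `x` give elements `c(f) a'_{x⁻¹,xfx⁻¹}` to which the
recognition lemma applies. -/

noncomputable section

/-! ### The ring underlying an algebra in `Z(G)`, and constructors for algebras and morphisms. -/

namespace GradedAlgebra

open MonObj

variable {k G : Type u} [Field k] [Group G] [Fintype G]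

section Ring

variable (A : Mon (ZObj k G))

/-- The multiplication of an algebra in `Z(G)` as a bilinear map. -/
def mulLin : A.X.V →ₗ[k] A.X.V →ₗ[k] A.X.V :=
  TensorProduct.curry (R := k) (ZObj.Hom.lin (μ[A.X] : ZObj.tensor A.X A.X ⟶ A.X))

/-- The unit element of an algebra in `Z(G)`. -/
def oneElt : A.X.V := ZObj.Hom.lin (η[A.X] : ZObj.unit ⟶ A.X) (1 : k)

theorem oneElt_mulLin (a : A.X.V) : mulLin A (oneElt A) a = a := by
  have h := congrArg (fun f : ZObj.tensor ZObj.unit A.X ⟶ A.X => f.lin ((1 : k) ⊗ₜ[k] a))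
    (MonObj.one_mul A.X)
  exact h.trans (one_smul k a)

theorem mulLin_oneElt (a : A.X.V) : mulLin A a (oneElt A) = a := by
  have h := congrArg (fun f : ZObj.tensor A.X ZObj.unit ⟶ A.X => f.lin (a ⊗ₜ[k] (1 : k)))
    (MonObj.mul_one A.X)
  exact h.trans (one_smul k a)

theorem mulLin_assoc (a b c : A.X.V) :
    mulLin A (mulLin A a b) c = mulLin A a (mulLin A b c) :=
  congrArg (fun f : ZObj.tensor (ZObj.tensor A.X A.X) A.X ⟶ A.X => f.lin ((a ⊗ₜ[k] b) ⊗ₜ[k] c))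
    (MonObj.mul_assoc A.X)

/-- The ring underlying an algebra in `Z(G)`. -/
instance instRing : Ring A.X.V :=
  { A.X.addCommGroup with
    mul a b := mulLin A a b
    one := oneElt A
    left_distrib a b c := map_add (mulLin A a) b c
    right_distrib a b c := (congrArg (fun f => f c) (map_add (mulLin A) a b) :)
    zero_mul a := (congrArg (fun f => f a) (map_zero (mulLin A)) :)
    mul_zero a := map_zero (mulLin A a)
    mul_assoc := mulLin_assoc A
    one_mul := oneElt_mulLin A
    mul_one := mulLin_oneElt A }

instance instAlgebra : Algebra k A.X.V :=
  Algebra.ofModule (fun c a b => LinearMap.congr_fun (map_smul (mulLin A) c a) b)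
    (fun c a b => map_smul (mulLin A a) c b)

/-- The multiplication of an algebra in `Z(G)` as a linear map on the tensor product. -/
def mulTensor : A.X.V ⊗[k] A.X.V →ₗ[k] A.X.V :=
  ZObj.Hom.lin (μ[A.X] : ZObj.tensor A.X A.X ⟶ A.X)

variable {A}

theorem mulTensor_tmul (a b : A.X.V) : mulTensor A (a ⊗ₜ[k] b) = a * b := rfl

theorem one_def : (1 : A.X.V) = ZObj.Hom.lin (η[A.X] : ZObj.unit ⟶ A.X) (1 : k) := rfl

theorem sum_proj_mul_proj (g : G) (a b : A.X.V) :
    ∑ x, A.X.proj x a * A.X.proj (x⁻¹ * g) b = A.X.proj g (a * b) := by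
  have h := ZObj.Hom.lin_proj (μ[A.X] : ZObj.tensor A.X A.X ⟶ A.X) g (a ⊗ₜ[k] b)
  change mulTensor A (tensorProj A.X.proj A.X.proj g (a ⊗ₜ[k] b)) = A.X.proj g (a * b) at h
  rw [← h, tensorProj_tmul, map_sum]
  simp only [mulTensor_tmul]

theorem act_mul (g : G) (a b : A.X.V) : A.X.act g (a * b) = A.X.act g a * A.X.act g b :=
  (ZObj.Hom.lin_act (μ[A.X] : ZObj.tensor A.X A.X ⟶ A.X) g (a ⊗ₜ[k] b)).symm

theorem act_one (g : G) : A.X.act g (1 : A.X.V) = 1 :=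
  (ZObj.Hom.lin_act (η[A.X] : ZObj.unit ⟶ A.X) g (1 : k)).symm

theorem proj_one : A.X.proj 1 (1 : A.X.V) = 1 := by
  have h := ZObj.Hom.lin_proj (η[A.X] : ZObj.unit ⟶ A.X) 1 (1 : k)
  rw [one_def, ← h]
  change ZObj.Hom.lin (η[A.X] : ZObj.unit ⟶ A.X) (unitProj k G 1 1) = _
  rw [unitProj_one]; rfl

theorem proj_mul_of_left {x : G} {a : A.X.V} (ha : A.X.proj x a = a) (g : G) (b : A.X.V) :
    A.X.proj g (a * b) = a * A.X.proj (x⁻¹ * g) b := by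
  rw [← sum_proj_mul_proj, Finset.sum_eq_single x, ha]
  · intro y _ hy
    rw [← ha, ZObj.proj_of_ne _ _ _ _ hy, zero_mul]
  · simp

theorem proj_mul_of_mem {x y : G} {a b : A.X.V} (ha : A.X.proj x a = a) (hb : A.X.proj y b = b) :
    A.X.proj (x * y) (a * b) = a * b := by
  rw [proj_mul_of_left ha, inv_mul_cancel_left, hb]

theorem proj_act_of_mem {x : G} {a : A.X.V} (ha : A.X.proj x a = a) (g : G) :
    A.X.proj (g * x * g⁻¹) (A.X.act g a) = A.X.act g a := by
  rw [← A.X.act_proj, ha]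

theorem mul_eq_sum_of_comm (h : IsCommMonObj A.X) (a b : A.X.V) :
    a * b = ∑ f, A.X.act f b * A.X.proj f a := by
  have h' := congrArg (fun f : ZObj.tensor A.X A.X ⟶ A.X => f.lin (a ⊗ₜ[k] b)) h.mul_comm
  refine h'.symm.trans ?_
  change mulTensor A (braidMap A.X.proj A.X.act (a ⊗ₜ[k] b)) = _
  rw [braidMap_tmul, map_sum]
  simp only [mulTensor_tmul]

/-- On a homogeneous left factor the braiding has a single term. For `x = 1` this says that elements
of degree one are central, and for general `x` it is the source of the third axiom of a quadruple.
-/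
theorem mul_comm_of_mem (h : IsCommMonObj A.X) {x : G} {a : A.X.V} (ha : A.X.proj x a = a)
    (b : A.X.V) : a * b = A.X.act x b * a := by
  rw [mul_eq_sum_of_comm h, Finset.sum_eq_single x, ha]
  · intro y _ hy
    rw [← ha, ZObj.proj_of_ne _ _ _ _ hy, mul_zero]
  · simp

end Ring

/-- A homogeneous invariant element of degree `1` as a morphism from the unit. -/
def ofInvariant {X : ZObj k G} (v : X.V) (hp : X.proj 1 v = v) (ha : ∀ g, X.act g v = v) :
    ZObj.unit ⟶ X where
  lin := LinearMap.toSpanSingleton k X.V v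
  lin_proj x := LinearMap.congr_fun
    (f := LinearMap.toSpanSingleton k X.V v ∘ₗ unitProj k G x)
    (g := X.proj x ∘ₗ LinearMap.toSpanSingleton k X.V v)
    (LinearMap.ext_ring (by
      by_cases h : x = 1
      · subst h; simp [unitProj_one, hp]
      · have := X.proj_of_ne x 1 v h
        rw [hp] at this
        simp [unitProj_ne h, this]))
  lin_act x := LinearMap.congr_fun
    (f := LinearMap.toSpanSingleton k X.V v ∘ₗ Representation.trivial k G k x)
    (g := X.act x ∘ₗ LinearMap.toSpanSingleton k X.V v)
    (LinearMap.ext_ring (by simp [ha]))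

/-- An algebra in `Z(G)` from an object with a compatible bilinear multiplication and a unit. -/
def ofMul (X : ZObj k G) (m : X.V →ₗ[k] X.V →ₗ[k] X.V) (e : X.V)
    (proj_m : ∀ g a b, ∑ x, m (X.proj x a) (X.proj (x⁻¹ * g) b) = X.proj g (m a b))
    (act_m : ∀ g a b, m (X.act g a) (X.act g b) = X.act g (m a b))
    (proj_e : X.proj 1 e = e) (act_e : ∀ g, X.act g e = e)
    (e_m : ∀ a, m e a = a) (m_e : ∀ a, m a e = a)
    (m_assoc : ∀ a b c, m (m a b) c = m a (m b c)) : Mon (ZObj k G) where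
  X := X
  mon :=
    { one := ofInvariant e proj_e act_e
      mul := show ZObj.tensor X X ⟶ X from
        { lin := TensorProduct.lift m
          lin_proj x := LinearMap.congr_fun
            (f := TensorProduct.lift m ∘ₗ tensorProj X.proj X.proj x)
            (g := X.proj x ∘ₗ TensorProduct.lift m)
            (TensorProduct.ext' fun a b => by simp [tensorProj_tmul, proj_m])
          lin_act x := LinearMap.congr_fun
            (f := TensorProduct.lift m ∘ₗ X.act.tprod X.act x)
            (g := X.act x ∘ₗ TensorProduct.lift m)
            (TensorProduct.ext' fun a b => by simp [act_m]) }
      one_mul := ZObj.hom_ext (TensorProduct.ext' fun (c : k) (a : X.V) => by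
        change m (c • e) a = c • a
        simp [e_m])
      mul_one := ZObj.hom_ext (TensorProduct.ext' fun (a : X.V) (c : k) => by
        change m a (c • e) = c • a
        simp [m_e])
      mul_assoc := ZObj.hom_ext (TensorProduct.ext_threefold fun a b c => m_assoc a b c) }

/-- A morphism of algebras in `Z(G)` from a linear map preserving all the structure. -/
def homMk {A B : Mon (ZObj k G)} (φ : A.X.V →ₗ[k] B.X.V)
    (hp : ∀ g a, φ (A.X.proj g a) = B.X.proj g (φ a)) (ha : ∀ g a, φ (A.X.act g a) = B.X.act g (φ a))
    (h1 : φ 1 = 1) (hm : ∀ a b, φ (a * b) = φ a * φ b) : A ⟶ B :=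
  Mon.Hom.mk' (show A.X ⟶ B.X from ⟨φ, hp, ha⟩)
    (ZObj.hom_ext (LinearMap.ext_ring h1))
    (ZObj.hom_ext (TensorProduct.ext' fun a b => hm a b))

/-- An isomorphism of algebras in `Z(G)` from a bijective linear map preserving all the structure. -/
theorem nonempty_iso {A B : Mon (ZObj k G)} (φ : A.X.V →ₗ[k] B.X.V)
    (hp : ∀ g a, φ (A.X.proj g a) = B.X.proj g (φ a)) (ha : ∀ g a, φ (A.X.act g a) = B.X.act g (φ a))
    (h1 : φ 1 = 1) (hm : ∀ a b, φ (a * b) = φ a * φ b) (hb : Function.Bijective φ) :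
    Nonempty (A ≅ B) :=
  ⟨Mon.mkIso (ZObj.mkIso (LinearEquiv.ofBijective φ hb) hp ha)
    (ZObj.hom_ext (LinearMap.ext_ring h1))
    (ZObj.hom_ext (TensorProduct.ext' fun a b => hm a b))⟩

section Hom

variable {A B : Mon (ZObj k G)} (f : A ⟶ B)

theorem hom_one : f.hom.lin (1 : A.X.V) = (1 : B.X.V) :=
  congrArg (fun φ : ZObj.unit ⟶ B.X => φ.lin (1 : k)) (IsMonHom.one_hom (f := f.hom))

theorem hom_mul (a b : A.X.V) : f.hom.lin (a * b) = f.hom.lin a * f.hom.lin b :=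
  congrArg (fun φ : ZObj.tensor A.X A.X ⟶ B.X => φ.lin (a ⊗ₜ[k] b)) (IsMonHom.mul_hom (f := f.hom))

theorem iso_inv_hom (i : A ≅ B) (a : A.X.V) : i.inv.hom.lin (i.hom.hom.lin a) = a :=
  congrArg (fun φ : A ⟶ A => φ.hom.lin a) i.hom_inv_id

theorem iso_hom_injective (i : A ≅ B) : Function.Injective i.hom.hom.lin :=
  Function.LeftInverse.injective (iso_inv_hom i)

end Hom

/-! ### Separability expressed by a functional and a dual pair of finite families. -/

section Separable

variable {A : Mon (ZObj k G)}

/-- Both sides are linear in the copairing `κ(1)`, and on pure tensors they agree by definition.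
Passing `x` and `t'` with equations lets `κ(1)` be replaced by an explicit sum of tensors. -/
theorem snake_left_apply (t : A.X ⟶ 𝟙_ (ZObj k G)) (κ : 𝟙_ (ZObj k G) ⟶ A.X ⊗ A.X)
    (x : A.X.V ⊗[k] A.X.V) (t' : A.X.V →ₗ[k] k) (hx : κ.lin (1 : k) = x) (ht : t.lin = t') (a : A.X.V) :
    ZObj.Hom.lin ((ρ_ A.X).inv ≫ A.X ◁ κ ≫ (α_ A.X A.X A.X).inv ≫ (μ[A.X] ≫ t) ▷ A.X ≫
      (λ_ A.X).hom) a =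
    TensorProduct.lid k A.X.V (TensorProduct.map (t' ∘ₗ LinearMap.mulLeft k a) LinearMap.id x) := by
  subst hx ht
  exact LinearMap.congr_fun
    (f := (TensorProduct.lid k A.X.V).toLinearMap ∘ₗ
      TensorProduct.map ((t.lin : A.X.V →ₗ[k] k) ∘ₗ mulTensor A) LinearMap.id ∘ₗ
      (TensorProduct.assoc k A.X.V A.X.V A.X.V).symm.toLinearMap ∘ₗ
      TensorProduct.mk k A.X.V (A.X.V ⊗[k] A.X.V) a)
    (g := (TensorProduct.lid k A.X.V).toLinearMap ∘ₗ
      TensorProduct.map ((t.lin : A.X.V →ₗ[k] k) ∘ₗ LinearMap.mulLeft k a) LinearMap.id)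
    (TensorProduct.ext' fun x y => rfl) (κ.lin (1 : k))

theorem snake_right_apply (t : A.X ⟶ 𝟙_ (ZObj k G)) (κ : 𝟙_ (ZObj k G) ⟶ A.X ⊗ A.X)
    (x : A.X.V ⊗[k] A.X.V) (t' : A.X.V →ₗ[k] k) (hx : κ.lin (1 : k) = x) (ht : t.lin = t') (a : A.X.V) :
    ZObj.Hom.lin ((λ_ A.X).inv ≫ κ ▷ A.X ≫ (α_ A.X A.X A.X).hom ≫ A.X ◁ (μ[A.X] ≫ t) ≫
      (ρ_ A.X).hom) a =
    TensorProduct.rid k A.X.V (TensorProduct.map LinearMap.id (t' ∘ₗ LinearMap.mulRight k a) x) := by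
  subst hx ht
  exact LinearMap.congr_fun
    (f := (TensorProduct.rid k A.X.V).toLinearMap ∘ₗ
      TensorProduct.map LinearMap.id ((t.lin : A.X.V →ₗ[k] k) ∘ₗ mulTensor A) ∘ₗ
      (TensorProduct.assoc k A.X.V A.X.V A.X.V).toLinearMap ∘ₗ
      (TensorProduct.mk k (A.X.V ⊗[k] A.X.V) A.X.V).flip a)
    (g := (TensorProduct.rid k A.X.V).toLinearMap ∘ₗ
      TensorProduct.map LinearMap.id ((t.lin : A.X.V →ₗ[k] k) ∘ₗ LinearMap.mulRight k a))
    (TensorProduct.ext' fun x y => rfl) (κ.lin (1 : k))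

/-- A separable algebra has an invariant functional with a dual pair of finite families. -/
theorem exists_dual_of_isSeparableAlgebra (h : IsSeparableAlgebra A) :
    ∃ (t : A.X.V →ₗ[k] k) (S : Finset (A.X.V × A.X.V)),
      (∀ g a, g ≠ 1 → t (A.X.proj g a) = 0) ∧ (∀ g a, t (A.X.act g a) = t a) ∧
      (∀ a, ∑ i ∈ S, t (a * i.1) • i.2 = a) ∧ (∀ a, ∑ i ∈ S, t (i.2 * a) • i.1 = a) ∧
      ∑ i ∈ S, i.1 * i.2 = 1 := by
  obtain ⟨t, κ, h1, h2, h3⟩ := h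
  obtain ⟨S, hS⟩ := TensorProduct.exists_finset (show A.X.V ⊗[k] A.X.V from κ.lin (1 : k))
  obtain ⟨t', ht⟩ : ∃ t' : A.X.V →ₗ[k] k, t.lin = t' := ⟨_, rfl⟩
  refine ⟨t', S, fun g a hg => ?_, fun g a => ht ▸ t.lin_act g a, fun a => ?_, fun a => ?_, ?_⟩
  · subst ht
    refine (t.lin_proj g a).trans ?_
    change unitProj k G g (t.lin a) = 0
    rw [unitProj_ne hg]; rfl
  · have := (snake_left_apply t κ _ t' hS ht a).symm.trans (congrArg (fun f : A.X ⟶ A.X => f.lin a) h1)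
    simpa using this
  · have := (snake_right_apply t κ _ t' hS ht a).symm.trans (congrArg (fun f : A.X ⟶ A.X => f.lin a) h2)
    simpa using this
  · have h4 := congrArg (fun f : ZObj.unit ⟶ A.X => f.lin (1 : k)) h3
    change mulTensor A (show A.X.V ⊗[k] A.X.V from κ.lin (1 : k)) = 1 at h4
    rw [hS, map_sum] at h4
    exact h4

/-- An invariant functional supported in degree `1` as a morphism to the unit. -/
def ofFunctional {X : ZObj k G} (t : X.V →ₗ[k] k) (hp : ∀ g a, g ≠ 1 → t (X.proj g a) = 0)
    (ha : ∀ g a, t (X.act g a) = t a) : X ⟶ ZObj.unit where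
  lin := t
  lin_proj g a := by
    change t (X.proj g a) = unitProj k G g (t a)
    by_cases h : g = 1
    · subst h
      conv_rhs => rw [← X.sum_proj a, map_sum, Finset.sum_eq_single 1 (fun b _ hb => hp b a hb) (by simp)]
      rw [unitProj_one]; rfl
    · rw [unitProj_ne h, hp g a h]; rfl
  lin_act g a := ha g a

/-- Converse of `exists_dual_of_isSeparableAlgebra`. The conditions `hκ` and `hκ'` make the tensor
homogeneous of degree one and invariant, which is what a morphism from the unit requires; `h1` and
`h2` are the two snake identities. -/
theorem isSeparableAlgebra_of_dual {I : Type*} (S : Finset I) (t : A.X.V →ₗ[k] k) (x y : I → A.X.V)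
    (hp : ∀ g a, g ≠ 1 → t (A.X.proj g a) = 0) (ha : ∀ g a, t (A.X.act g a) = t a)
    (hκ : tensorProj A.X.proj A.X.proj 1 (∑ i ∈ S, x i ⊗ₜ[k] y i) = ∑ i ∈ S, x i ⊗ₜ[k] y i)
    (hκ' : ∀ g, ∑ i ∈ S, A.X.act g (x i) ⊗ₜ[k] A.X.act g (y i) = ∑ i ∈ S, x i ⊗ₜ[k] y i)
    (h1 : ∀ a, ∑ i ∈ S, t (a * x i) • y i = a) (h2 : ∀ a, ∑ i ∈ S, t (y i * a) • x i = a)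
    (h3 : ∑ i ∈ S, x i * y i = 1) : IsSeparableAlgebra A := by
  let κ : ZObj.unit ⟶ ZObj.tensor A.X A.X := ofInvariant (X := ZObj.tensor A.X A.X)
    (∑ i ∈ S, x i ⊗ₜ[k] y i) hκ (fun g => by
      change A.X.act.tprod A.X.act g (∑ i ∈ S, x i ⊗ₜ[k] y i) = _
      rw [map_sum]; exact hκ' g)
  have hk : κ.lin (1 : k) = ∑ i ∈ S, x i ⊗ₜ[k] y i := one_smul k _
  refine ⟨ofFunctional t hp ha, κ, ZObj.hom_ext (LinearMap.ext fun a => ?_),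
    ZObj.hom_ext (LinearMap.ext fun a => ?_), ZObj.hom_ext (LinearMap.ext_ring ?_)⟩
  · refine (snake_left_apply _ κ _ t hk rfl a).trans ?_
    simpa using h1 a
  · refine (snake_right_apply _ κ _ t hk rfl a).trans ?_
    simpa using h2 a
  · change mulTensor A (show A.X.V ⊗[k] A.X.V from κ.lin (1 : k)) = 1
    rw [hk, map_sum]
    exact h3

end Separable

end GradedAlgebra

/-! ### The algebra of a quadruple is commutative, separable and indecomposable. -/

namespace Quadruple

open GradedAlgebra

variable {k G : Type u} [Field k] [Group G] (Q : Quadruple k G)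

/-- Each `a_{g,f}` is a scalar multiple of some `a_{g₀,f'}` with `g₀` the chosen representative of
`gH`. This reduces checks to the index set `(G/H) × F` of the dual bases. -/
theorem ext_out {W : Type*} [AddCommGroup W] [Module k W] {φ ψ : Q.Carrier →ₗ[k] W}
    (h : ∀ (c : G ⧸ Q.H) f, φ (Q.gen c.out f) = ψ (Q.gen c.out f)) : φ = ψ := by
  refine Submodule.linearMap_qext _ (Finsupp.lhom_ext' fun t => LinearMap.ext_ring ?_)
  change φ (Q.gen t.1 t.2) = ψ (Q.gen t.1 t.2)
  obtain ⟨s, f', hs⟩ := Q.exists_gen_eq (g := (t.1 : G ⧸ Q.H).out) (g' := t.1)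
    (QuotientGroup.eq.1 (Quotient.out_eq _)) t.2
  rw [hs, map_smul, map_smul, h]

theorem conj_injective (h : Q.H) : Function.Injective (Q.conj h) :=
  Function.LeftInverse.injective (g := Q.conj h⁻¹) fun f => by
    rw [← mul_conj, inv_mul_cancel, one_conj]

theorem algebra_one [Fintype G] : (1 : Q.algebra.X.V) = Q.one := one_smul k Q.one

open Classical in
/-- The trace functional, sending `a_{g,1}` to `1` and `a_{g,f}` to `0` for `f ≠ 1`. -/
def trace : Q.Carrier →ₗ[k] k :=
  Q.lift (fun _ f => if f = 1 then 1 else 0) (fun g h f => by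
    have : Q.conj h f = 1 ↔ f = 1 := by
      rw [← (Q.conj_injective h).eq_iff (a := f), conj_one]
    by_cases hf : f = 1
    · subst hf; simp [conj_one, ε_one_right]
    · simp [hf, this])

open Classical in
@[simp] theorem trace_gen (g : G) (f : Q.F) : Q.trace (Q.gen g f) = if f = 1 then 1 else 0 := by
  simp [trace]

theorem gen_one_ne_zero (g : G) : Q.gen g 1 ≠ 0 := fun h => by
  have := Q.trace_gen g 1
  simp [h] at this

/-- Multiplication by `a_{g,f⁻¹}` gives a unit multiple of `a_{g,1}`, whose trace is `1`. -/
theorem gen_ne_zero (g : G) (f : Q.F) : Q.gen g f ≠ 0 := fun h => by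
  have := Q.mul_gen_same g f f⁻¹
  rw [h, map_zero, LinearMap.zero_apply, mul_inv_cancel] at this
  exact (smul_ne_zero (Units.ne_zero _) (Q.gen_one_ne_zero g)) this.symm

theorem γ_inv_comm (f : Q.F) : Q.γ f f⁻¹ = Q.γ f⁻¹ f := by
  simpa [γ_one_left, γ_one_right] using Q.γ_cocycle f f⁻¹ f

theorem conj_inv (h : Q.H) (f : Q.F) : Q.conj h f⁻¹ = (Q.conj h f)⁻¹ :=
  Subtype.ext (by simp [conjOn, mul_assoc])

/-- Conjugation by an element of `H` as a permutation of `F`. -/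
def conjEquiv (h : Q.H) : Q.F ≃ Q.F where
  toFun := Q.conj h
  invFun := Q.conj h⁻¹
  left_inv f := by rw [← mul_conj, inv_mul_cancel, one_conj]
  right_inv f := by rw [← mul_conj, mul_inv_cancel, one_conj]

/-- Within one coset the claim reduces to `g' = g`. There `gfg⁻¹ · g = g · f`, so the action of the
degree produces the factor `ε_f`, and the third axiom is exactly the required identity. For distinct
cosets both products vanish, because `gfg⁻¹` fixes the coset `gH` and so cannot move `g'H` to it. -/
theorem commutator_gen (g : G) (f : Q.F) (g' : G) (f' : Q.F) :
    Q.mul (Q.gen g f) (Q.gen g' f') =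
      Q.mul (Q.act (Q.degree g f) (Q.gen g' f')) (Q.gen g f) := by
  by_cases h : g⁻¹ * g' ∈ Q.H
  · obtain ⟨s, e, he⟩ := Q.exists_gen_eq h f'
    have h1 : Q.degree g f * g = g * (⟨f, Q.F_le f.2⟩ : Q.H) := by simp [degree]
    rw [he, map_smul, map_smul, map_smul, LinearMap.smul_apply, act_gen, h1, gen_mul, map_smul,
      LinearMap.smul_apply, mul_gen_same, mul_gen_same, smul_smul (Q.ε _ _ : k), ← Units.val_mul,
      ← Q.eps3, smul_smul]
    have h2 : Q.conj ⟨f, Q.F_le f.2⟩ e * f = f * e := Subtype.ext (by simp [conjOn])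
    rw [h2, smul_smul]
  · rw [mul_gen_of_notMem _ h, act_gen, mul_gen_of_notMem]
    intro h'
    apply h
    have h2 : (g⁻¹ * g')⁻¹ * (f : G)⁻¹ ∈ Q.H := by simpa [degree, mul_assoc] using h'
    have h3 := Q.H.mul_mem h2 (Q.F_le f.2)
    simpa using Q.H.inv_mem h3

theorem isCommMonObj_algebra [Fintype G] : IsCommMonObj Q.algebra.X where
  mul_comm := ZObj.hom_ext (TensorProduct.ext (Q.ext fun g f => Q.ext fun g' f' => by
    classical
    change TensorProduct.lift Q.mul (braidMap Q.proj Q.act (Q.gen g f ⊗ₜ[k] Q.gen g' f')) =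
      Q.mul (Q.gen g f) (Q.gen g' f')
    rw [braidMap_tmul, map_sum, Finset.sum_eq_single (Q.degree g f), commutator_gen]
    · rw [proj_gen, if_pos rfl, TensorProduct.lift.tmul]
    · intro b _ hb
      rw [proj_gen, if_neg hb.symm, TensorProduct.tmul_zero, map_zero]
    · simp))

section Dual

/-- One half of a pair of dual bases for the trace form. -/
def dualLeft (i : (G ⧸ Q.H) × Q.F) : Q.Carrier :=
  ((Q.γ i.2 i.2⁻¹)⁻¹ : kˣ) • Q.gen i.1.out i.2

/-- The other half of a pair of dual bases for the trace form. -/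
def dualRight (i : (G ⧸ Q.H) × Q.F) : Q.Carrier := Q.gen i.1.out i.2⁻¹

theorem out_notMem {c d : G ⧸ Q.H} (h : c ≠ d) : c.out⁻¹ * d.out ∉ Q.H := fun h' => h (by
  simpa using QuotientGroup.eq.2 h')

-- For `v = a_{g,f}` with `g` a chosen representative, orthogonality of cosets and the support of
-- the trace leave only the index `(gH, f⁻¹)`; the coefficient in `dualLeft` cancels `γ(f,f⁻¹) =
-- γ(f⁻¹,f)`.
open Classical in
theorem sum_trace_mul_dualLeft [Fintype G] (v : Q.Carrier) :
    ∑ i, Q.trace (Q.mul v (Q.dualLeft i)) • Q.dualRight i = v := by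
  have : ∑ i, (Q.trace ∘ₗ Q.mul.flip (Q.dualLeft i)).smulRight (Q.dualRight i) = LinearMap.id :=
    Q.ext_out fun c f => by
      rw [LinearMap.sum_apply, Finset.sum_eq_single (c, f⁻¹)]
      · simp [dualLeft, dualRight, mul_gen_same, Units.smul_def, ← Q.γ_inv_comm f]
      · rintro ⟨d, e⟩ - hne
        by_cases hd : c = d
        · subst hd
          have : f * e ≠ 1 := fun h => hne (by rw [eq_inv_of_mul_eq_one_right h])
          simp [dualLeft, mul_gen_same, Units.smul_def, this]
        · simp [dualLeft, mul_gen_of_notMem _ (Q.out_notMem hd), Units.smul_def]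
      · simp
  simpa [LinearMap.sum_apply] using LinearMap.congr_fun this v

open Classical in
theorem sum_trace_dualRight_mul [Fintype G] (v : Q.Carrier) :
    ∑ i, Q.trace (Q.mul (Q.dualRight i) v) • Q.dualLeft i = v := by
  have : ∑ i, (Q.trace ∘ₗ Q.mul (Q.dualRight i)).smulRight (Q.dualLeft i) = LinearMap.id :=
    Q.ext_out fun c f => by
      rw [LinearMap.sum_apply, Finset.sum_eq_single (c, f)]
      · simp [dualLeft, dualRight, mul_gen_same, Units.smul_def, Q.γ_inv_comm f]
      · rintro ⟨d, e⟩ - hne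
        by_cases hd : c = d
        · subst hd
          have : e⁻¹ * f ≠ 1 := fun h => hne (by rw [inv_mul_eq_one.1 h])
          simp [dualRight, mul_gen_same, this]
        · simp [dualRight, mul_gen_of_notMem _ (Q.out_notMem (Ne.symm hd))]
      · simp
  simpa [LinearMap.sum_apply] using LinearMap.congr_fun this v

-- Every `f` contributes the same `a_{g,1}`, whence the factor `|F|`. It is this factor that makes a
-- rescaling of the trace necessary.
open Classical in
theorem sum_dualLeft_mul_dualRight [Fintype G] :
    ∑ i, Q.mul (Q.dualLeft i) (Q.dualRight i) = (Fintype.card Q.F : k) • Q.one := by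
  rw [Fintype.sum_prod_type, one, Finset.smul_sum]
  refine Finset.sum_congr rfl fun c _ => ?_
  simp [dualLeft, dualRight, mul_gen_same, Units.smul_def, idem, Nat.cast_smul_eq_nsmul]

-- The copairing restricted to one coset is independent of the representative, which gives its
-- invariance under `G`. Changing `g` to `gh` produces `ε_h(f) ε_h(f⁻¹)`, and the second axiom at
-- `(f, f⁻¹)` turns this into the change from `γ(f,f⁻¹)` to its conjugate.
open Classical in
theorem tensor_gen_mul [Fintype G] (g : G) (h : Q.H) :
    ∑ f, ((Q.γ f f⁻¹)⁻¹ : kˣ) • Q.gen (g * h) f ⊗ₜ[k] Q.gen (g * h) f⁻¹ =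
      ∑ f, ((Q.γ f f⁻¹)⁻¹ : kˣ) • Q.gen g f ⊗ₜ[k] Q.gen g f⁻¹ := by
  rw [← Equiv.sum_comp (Q.conjEquiv h)
    (fun f => ((Q.γ f f⁻¹)⁻¹ : kˣ) • Q.gen g f ⊗ₜ[k] Q.gen g f⁻¹)]
  refine Finset.sum_congr rfl fun f _ => ?_
  have h1 := Q.eps2 h f f⁻¹
  rw [mul_inv_cancel, ε_one_right, mul_one] at h1
  change _ = ((Q.γ (Q.conj h f) (Q.conj h f)⁻¹)⁻¹ : kˣ) • Q.gen g (Q.conj h f) ⊗ₜ[k]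
    Q.gen g (Q.conj h f)⁻¹
  rw [gen_mul, gen_mul, ← conj_inv, TensorProduct.smul_tmul_smul, ← Units.val_mul,
    ← Units.smul_def, smul_smul, h1]
  congr 1
  rw [mul_inv, inv_mul_cancel_comm]

end Dual

theorem isSeparableAlgebra_algebra [Fintype G] [CharZero k] : IsSeparableAlgebra Q.algebra := by
  classical
  have hF : (Fintype.card Q.F : k) ≠ 0 := Nat.cast_ne_zero.2 Fintype.card_ne_zero
  have hT : ∀ g, ∑ f, ((Q.γ f f⁻¹)⁻¹ : kˣ) • Q.gen g f ⊗ₜ[k] Q.gen g f⁻¹ =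
      ∑ f, Q.dualLeft (g, f) ⊗ₜ[k] Q.dualRight (g, f) := fun g => by
    obtain ⟨h, hh⟩ := QuotientGroup.mk_out_eq_mul Q.H g
    rw [← Q.tensor_gen_mul g h, ← hh]
    rfl
  -- Scaling the trace by `|F|` and one dual family by `|F|⁻¹` preserves duality and normalises `μκ`
  -- to the unit; `|F|` is invertible in characteristic zero.
  refine isSeparableAlgebra_of_dual (A := Q.algebra) Finset.univ ((Fintype.card Q.F : k) • Q.trace)
    (fun i => (Fintype.card Q.F : k)⁻¹ • Q.dualLeft i) Q.dualRight ?_ ?_ ?_ ?_ ?_ ?_ ?_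
  · intro g a hg
    refine LinearMap.congr_fun (f := ((Fintype.card Q.F : k) • Q.trace) ∘ₗ Q.proj g) (g := 0)
      (Q.ext fun g' f => ?_) a
    simp only [LinearMap.comp_apply, proj_gen]
    split_ifs with h
    · have : f ≠ 1 := by
        rintro rfl
        exact hg (by simp [← h, degree])
      simp [this]
    · simp
  · intro g a
    exact LinearMap.congr_fun (f := ((Fintype.card Q.F : k) • Q.trace) ∘ₗ Q.act g)
      (Q.ext fun g' f => by simp) a
  · change tensorProj Q.proj Q.proj 1 (∑ i, ((Fintype.card Q.F : k)⁻¹ • Q.dualLeft i) ⊗ₜ[k]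
      Q.dualRight i) = ∑ i, ((Fintype.card Q.F : k)⁻¹ • Q.dualLeft i) ⊗ₜ[k] Q.dualRight i
    rw [map_sum]
    refine Finset.sum_congr rfl fun ⟨c, f⟩ _ => ?_
    have hd : Q.degree c.out f⁻¹ = (Q.degree c.out f)⁻¹ := by simp [degree, mul_assoc]
    rw [tensorProj_tmul, Finset.sum_eq_single (Q.degree c.out f)]
    · simp [dualLeft, dualRight, proj_gen, hd, Units.smul_def]
    · intro b _ hb
      simp [dualLeft, proj_gen, hb.symm, Units.smul_def]
    · simp
  · intro g
    change ∑ i, Q.act g ((Fintype.card Q.F : k)⁻¹ • Q.dualLeft i) ⊗ₜ[k] Q.act g (Q.dualRight i) =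
      ∑ i, ((Fintype.card Q.F : k)⁻¹ • Q.dualLeft i) ⊗ₜ[k] Q.dualRight i
    simp only [map_smul, ← TensorProduct.smul_tmul', ← Finset.smul_sum]
    congr 1
    rw [Fintype.sum_prod_type, Fintype.sum_prod_type, ← Equiv.sum_comp (MulAction.toPerm g)
      (fun c : G ⧸ Q.H => ∑ f, Q.dualLeft (c, f) ⊗ₜ[k] Q.dualRight (c, f))]
    refine Finset.sum_congr rfl fun c _ => ?_
    induction c using QuotientGroup.induction_on with
    | H x =>
      refine Eq.trans ?_ (hT (g * x))
      have := congrArg (TensorProduct.map (Q.act g) (Q.act g)) (hT x)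
      simpa [Units.smul_def] using this.symm
  · intro a
    refine Eq.trans ?_ (Q.sum_trace_mul_dualLeft a)
    refine Finset.sum_congr rfl fun i _ => ?_
    change (((Fintype.card Q.F : k) • Q.trace) (Q.mul a ((Fintype.card Q.F : k)⁻¹ • Q.dualLeft i))) •
      Q.dualRight i = _
    simp [hF]
  · intro a
    refine Eq.trans ?_ (Q.sum_trace_dualRight_mul a)
    refine Finset.sum_congr rfl fun i _ => ?_
    change (((Fintype.card Q.F : k) • Q.trace) (Q.mul (Q.dualRight i) a)) •
      ((Fintype.card Q.F : k)⁻¹ • Q.dualLeft i) = _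
    rw [smul_smul]
    congr 1
    simp [hF, mul_comm]
  · rw [algebra_one]
    change ∑ i, Q.mul ((Fintype.card Q.F : k)⁻¹ • Q.dualLeft i) (Q.dualRight i) = Q.one
    simp only [map_smul, LinearMap.smul_apply]
    rw [← Finset.smul_sum, sum_dualLeft_mul_dualRight, smul_smul, inv_mul_cancel₀ hF, one_smul]

theorem gen_mem_span {Q : Quadruple k G} (v : Q.Carrier) :
    v ∈ Submodule.span k (Set.range fun i : G × Q.F => Q.gen i.1 i.2) := by
  have : (Submodule.span k (Set.range fun i : G × Q.F => Q.gen i.1 i.2)).mkQ = 0 :=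
    Q.ext fun g f => (Submodule.Quotient.mk_eq_zero _).2 (Submodule.subset_span ⟨(g, f), rfl⟩)
  exact (Submodule.Quotient.mk_eq_zero _).1 (LinearMap.congr_fun this v)

theorem gen_one_eq_iff {Q : Quadruple k G} (g g' : G) : Q.gen g' 1 = Q.gen g 1 ↔ g⁻¹ * g' ∈ Q.H := by
  constructor
  · intro h
    by_contra hn
    have h1 := Q.mul_gen_of_notMem hn 1 1
    rw [h, mul_gen_same, γ_one_left] at h1
    simp [gen_one_ne_zero] at h1
  · intro h
    rw [← Q.idem_mk, ← Q.idem_mk, QuotientGroup.eq.2 h]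

theorem proj_gen_self {Q : Quadruple k G} (g : G) (f : Q.F) :
    Q.proj (Q.degree g f) (Q.gen g f) = Q.gen g f := by
  rw [proj_gen, if_pos rfl]

theorem nontrivial_carrier : Nontrivial Q.Carrier := ⟨⟨_, _, Q.gen_one_ne_zero 1⟩⟩

/-- The invariants of degree `1` are the multiples of the unit. -/
theorem exists_eq_smul_one [Fintype G] [CharZero k] (v : Q.Carrier) (hp : Q.proj 1 v = v)
    (ha : ∀ g, Q.act g v = v) : ∃ s : k, v = s • Q.one := by
  classical
  have hG : (Fintype.card G : k) ≠ 0 := Nat.cast_ne_zero.2 Fintype.card_ne_zero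
  -- Summing over `G` and projecting to degree one has rank at most one: it kills `a_{g,f}` for `f ≠
  -- 1` and sends every `a_{g,1}` to `∑ a_{x,1}`. On invariants of degree one it is multiplication
  -- by `|G|`, so all of them, including the unit, are proportional to that vector.
  have key : Q.proj 1 ∘ₗ ∑ x, Q.act x = Q.trace.smulRight (∑ x, Q.gen x 1) :=
    Q.ext fun g f => by
      have hd : ∀ x, Q.degree x f = 1 ↔ f = 1 := fun x => by simp [degree]
      simp only [LinearMap.comp_apply, LinearMap.sum_apply, act_gen, map_sum, proj_gen, hd,
        LinearMap.smulRight_apply, trace_gen]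
      split_ifs with h
      · subst h
        rw [one_smul, ← Equiv.sum_comp (Equiv.mulRight g) (fun x => Q.gen x 1)]
        rfl
      · simp
  have hk : ∀ w, Q.proj 1 w = w → (∀ g, Q.act g w = w) →
      (Fintype.card G : k) • w = Q.trace w • ∑ x, Q.gen x 1 := fun w hw hw' => by
    have := LinearMap.congr_fun key w
    simpa [LinearMap.sum_apply, hw', hw, Nat.cast_smul_eq_nsmul] using this
  have h1 := hk Q.one Q.proj_one Q.act_one
  have hone : Q.one ≠ 0 := fun h => by
    have := Q.one_mul_gen 1 1
    rw [h, map_zero, LinearMap.zero_apply] at this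
    exact Q.gen_one_ne_zero 1 this.symm
  have ht : Q.trace Q.one ≠ 0 := fun h => by
    rw [h, zero_smul] at h1
    exact smul_ne_zero hG hone h1
  refine ⟨Q.trace v * (Q.trace Q.one)⁻¹, ?_⟩
  have h2 := hk v hp ha
  have h3 : ∑ x, Q.gen x 1 = ((Q.trace Q.one)⁻¹ * Fintype.card G : k) • Q.one := by
    rw [mul_smul, h1, smul_smul, inv_mul_cancel₀ ht, one_smul]
  rw [h3, smul_smul] at h2
  refine smul_right_injective _ hG ?_
  dsimp only
  rw [h2, smul_smul]
  congr 1
  ring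

/-- In a decomposition `B ⊕ C` the element `(1, 0)` is invariant of degree one, hence a scalar `s`
times the unit. Its image in `C` gives `s · 1 = 0`, so `s = 0` and `B` vanishes, or `C` vanishes. -/
theorem isIndecomposableAlgebra_algebra [Fintype G] [CharZero k] :
    IsIndecomposableAlgebra Q.algebra := by
  refine ⟨Q.nontrivial_carrier, fun B C p q hpq => ?_⟩
  obtain ⟨v, hv⟩ := hpq.2 ((1 : B.X.V), (0 : C.X.V))
  obtain ⟨hv1, hv2⟩ := Prod.ext_iff.1 hv
  dsimp only at hv1 hv2
  have hB := GradedAlgebra.proj_one (A := B)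
  have hB' := fun g => GradedAlgebra.act_one (A := B) g
  rw [← hv1] at hB hB'
  obtain ⟨s, hs⟩ := Q.exists_eq_smul_one v
    (hpq.1 (Prod.ext ((p.hom.lin_proj 1 v).trans hB)
      ((q.hom.lin_proj 1 v).trans (by rw [hv2, map_zero]; exact hv2.symm))))
    (fun g => hpq.1 (Prod.ext ((p.hom.lin_act g v).trans (hB' g))
      ((q.hom.lin_act g v).trans (by rw [hv2, map_zero]; exact hv2.symm))))
  have hq : q.hom.lin v = s • (1 : C.X.V) := by
    rw [← hom_one q, ← map_smul, hs, algebra_one]; rfl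
  by_cases h0 : s = 0
  · left
    rw [h0, zero_smul] at hs
    have h10 : (1 : B.X.V) = 0 := by
      rw [← hv1, hs]; exact map_zero _
    exact subsingleton_of_zero_eq_one h10.symm
  · right
    rw [hv2] at hq
    have h10 : (1 : C.X.V) = 0 := (smul_eq_zero.1 hq.symm).resolve_left h0
    exact subsingleton_of_zero_eq_one h10.symm

end Quadruple

/-! ### Recognition of `A(H,F,γ,ε)` and isomorphisms between algebras of quadruples. -/

namespace Quadruple

open GradedAlgebra

variable {k G : Type u} [Field k] [Group G] [Fintype G] (Q : Quadruple k G)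

theorem eq_zero_of_trace_mul {v : Q.Carrier} (h : ∀ w, Q.trace (Q.mul v w) = 0) : v = 0 := by
  classical
  rw [← Q.sum_trace_mul_dualLeft v]
  exact Finset.sum_eq_zero fun i _ => by rw [h, zero_smul]

open Classical in
/-- Recognition of `A(H, F, γ, ε)`: it is isomorphic to any algebra generated by homogeneous
elements `u f`, `f ∈ F`, with the same relations. -/
theorem nonempty_algebra_iso {A : Mon (ZObj k G)} (u : Q.F → A.X.V)
    (hdeg : ∀ f : Q.F, A.X.proj f (u f) = u f)
    (hmul : ∀ f f', u f * u f' = (Q.γ f f' : k) • u (f * f'))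
    (hact : ∀ (h : Q.H) f, A.X.act h (u f) = (Q.ε h f : k) • u (Q.conj h f))
    (horth : ∀ g, g ∉ Q.H → u 1 * A.X.act g (u 1) = 0)
    (hsum : ∑ c : G ⧸ Q.H, A.X.act c.out (u 1) = 1)
    (hspan : ∀ v, v ∈ Submodule.span k (Set.range fun i : G × Q.F => A.X.act i.1 (u i.2)))
    (t : A.X.V →ₗ[k] k) (ht : ∀ g f, t (A.X.act g (u f)) = if f = 1 then 1 else 0) :
    Nonempty (Q.algebra ≅ A) := by
  let φ : Q.Carrier →ₗ[k] A.X.V := Q.lift (fun g f => A.X.act g (u f)) (fun g h f => by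
    rw [map_mul, Module.End.mul_apply, hact, map_smul])
  have hφ : ∀ g f, φ (Q.gen g f) = A.X.act g (u f) := fun g f => Q.lift_gen _ _ g f
  have hφm : ∀ a b, φ (Q.mul a b) = φ a * φ b := by
    have h : (Q.mul).compr₂ φ = (LinearMap.mul k A.X.V).compl₁₂ φ φ :=
      Q.ext fun g f => Q.ext fun g' f' => by
        simp only [LinearMap.compr₂_apply, LinearMap.compl₁₂_apply, LinearMap.mul_apply', hφ]
        by_cases h : g⁻¹ * g' ∈ Q.H
        · obtain ⟨s, e, he⟩ := Q.exists_gen_eq h f'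
          rw [← hφ g', he, map_smul, map_smul, map_smul, mul_smul_comm, mul_gen_same, map_smul, hφ, hφ,
            ← act_mul, hmul, map_smul]
        -- For distinct cosets, inserting `u 1` on the inner sides of both factors exposes a product
        -- `u 1 · (g⁻¹g')(u 1)`, which `horth` kills.
        · have h1 : u f = u f * u 1 := by rw [hmul, γ_one_right]; simp
          have h2 : u f' = u 1 * u f' := by rw [hmul, γ_one_left]; simp
          have h3 : A.X.act g' (u f') = A.X.act g (A.X.act (g⁻¹ * g') (u f')) := by
            rw [← Module.End.mul_apply, ← map_mul, mul_inv_cancel_left]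
          rw [mul_gen_of_notMem _ h, map_zero, h3, ← act_mul, h1, h2, act_mul (g⁻¹ * g'), mul_assoc (u f),
            ← mul_assoc (u 1), horth _ h, zero_mul, mul_zero, map_zero]
    exact fun a b => LinearMap.congr_fun₂ h a b
  have htφ : ∀ v, t (φ v) = Q.trace v := fun v => LinearMap.congr_fun (f := t ∘ₗ φ)
    (Q.ext fun g f => by simp [hφ, ht]) v
  have hφ1 : φ Q.one = 1 := by
    rw [← hsum, one, map_sum]
    exact Finset.sum_congr rfl fun c _ => by rw [idem, hφ]
  refine nonempty_iso (A := Q.algebra) φ (fun g a => ?_) (fun g a => ?_) ?_ hφm ⟨?_, ?_⟩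
  · refine LinearMap.congr_fun (f := φ ∘ₗ Q.proj g) (g := A.X.proj g ∘ₗ φ) (Q.ext fun g' f => ?_) a
    have hd : A.X.proj (Q.degree g' f) (A.X.act g' (u f)) = A.X.act g' (u f) :=
      proj_act_of_mem (hdeg f) g'
    simp only [LinearMap.comp_apply, proj_gen, hφ]
    split_ifs with h
    · rw [hφ, ← h, hd]
    · rw [map_zero, ← hd, A.X.proj_of_ne _ _ _ (Ne.symm h)]
  · refine LinearMap.congr_fun (f := φ ∘ₗ Q.act g) (g := A.X.act g ∘ₗ φ) (Q.ext fun g' f => ?_) a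
    simp [hφ]
  · rw [algebra_one]
    exact hφ1
  -- No dimension count is needed: `φ` is multiplicative and transports `t` to the trace, so its
  -- kernel lies in the radical of the non-degenerate trace form.
  · change Function.Injective φ
    refine (injective_iff_map_eq_zero φ).2 fun v hv => Q.eq_zero_of_trace_mul fun w => ?_
    rw [← htφ, hφm, hv, zero_mul, map_zero]
  · change Function.Surjective φ
    refine LinearMap.range_eq_top.1 (top_unique fun v _ => ?_)
    refine Submodule.span_le.2 ?_ (hspan v)
    rintro _ ⟨⟨g, f⟩, rfl⟩
    exact ⟨Q.gen g f, hφ g f⟩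

variable {Q} {Q' : Quadruple k G}

/-- The elements `c(f) a'_{x⁻¹,xfx⁻¹}` have degree `f`, and the two conditions on `c` say that they
multiply by `γ` and transform by `ε`. The condition at `f = g = 1` forces `c(1) = 1`. The cosets
match through `gH ↦ gx⁻¹H'`. -/
theorem nonempty_iso_of_equivalent (h : Q.Equivalent Q') : Nonempty (Q.algebra ≅ Q'.algebra) := by
  classical
  obtain ⟨x, hH, hF, c, hc, hε⟩ := h
  let σ : Q.F → Q'.F := fun f => ⟨x * f * x⁻¹, (hF f).1 f.2⟩
  have hσm : ∀ f g, σ (f * g) = σ f * σ g := fun f g => Subtype.ext (by simp [σ])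
  have hσ1 : σ 1 = 1 := Subtype.ext (by simp [σ])
  have hσi : ∀ f, σ f = 1 ↔ f = 1 := fun f =>
    ⟨fun h => Subtype.ext (by simpa [σ] using congrArg Subtype.val h), fun h => h ▸ hσ1⟩
  have hc1 : c 1 = 1 := by
    have h1 := hc 1 1
    change c (1 * 1) * Q.γ 1 1 = Q'.γ (σ 1) (σ 1) * c 1 * c 1 at h1
    rw [hσ1, γ_one_left, γ_one_left] at h1
    simpa using h1
  have hu1 : ∀ g : G, Q'.act g ((c 1 : k) • Q'.gen x⁻¹ (σ 1)) = Q'.gen (g * x⁻¹) 1 := fun g => by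
    rw [hc1, hσ1, Units.val_one, one_smul, act_gen]
  refine nonempty_algebra_iso Q (A := Q'.algebra) (fun f => (c f : k) • Q'.gen x⁻¹ (σ f))
    (fun f => ?_) (fun f f' => ?_) (fun h f => ?_) (fun g hg => ?_) ?_ (fun v => ?_) Q'.trace
    (fun g f => ?_)
  · change Q'.proj f ((c f : k) • Q'.gen x⁻¹ (σ f)) = _
    rw [map_smul, proj_gen, if_pos (by simp [degree, σ, mul_assoc])]
  · change Q'.mul ((c f : k) • Q'.gen x⁻¹ (σ f)) ((c f' : k) • Q'.gen x⁻¹ (σ f')) =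
      (Q.γ f f' : k) • (c (f * f') : k) • Q'.gen x⁻¹ (σ (f * f'))
    rw [map_smul, map_smul, LinearMap.smul_apply, mul_gen_same, smul_smul, smul_smul, hσm,
      smul_smul]
    have h1 := congrArg Units.val (hc f f')
    congr 1
    push_cast at h1
    linear_combination -h1
  · change Q'.act h ((c f : k) • Q'.gen x⁻¹ (σ f)) =
      (Q.ε h f : k) • (c (Q.conj h f) : k) • Q'.gen x⁻¹ (σ (Q.conj h f))
    have h1 : (h : G) * x⁻¹ = x⁻¹ * (⟨x * h * x⁻¹, (hH h).1 h.2⟩ : Q'.H) := by simp [mul_assoc]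
    have h2 : Q'.conj ⟨x * h * x⁻¹, (hH h).1 h.2⟩ (σ f) = σ (Q.conj h f) :=
      Subtype.ext (by simp [conjOn, σ, mul_assoc])
    rw [map_smul, act_gen, h1, gen_mul, smul_smul, smul_smul, h2]
    congr 1
    exact (congrArg Units.val (hε h f)).symm
  · change Q'.mul ((c 1 : k) • Q'.gen x⁻¹ (σ 1)) (Q'.act g ((c 1 : k) • Q'.gen x⁻¹ (σ 1))) = 0
    rw [hu1, hc1, hσ1, Units.val_one, one_smul, mul_gen_of_notMem]
    rw [hH] at hg
    simpa [mul_assoc] using hg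
  · rw [algebra_one]
    change ∑ d : G ⧸ Q.H, Q'.act d.out ((c 1 : k) • Q'.gen x⁻¹ (σ 1)) = ∑ d, Q'.idem d
    simp only [hu1]
    have hrel : ∀ a b : G, a⁻¹ * b ∈ Q.H ↔ (a * x⁻¹)⁻¹ * (b * x⁻¹) ∈ Q'.H := fun a b => by
      rw [hH]; simp [mul_assoc]
    let e : G ⧸ Q.H → G ⧸ Q'.H := Quotient.map' (· * x⁻¹) fun a b hab => by
      rw [QuotientGroup.leftRel_apply] at hab ⊢
      exact (hrel a b).1 hab
    have he : Function.Bijective e := by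
      constructor
      · intro a b
        induction a using QuotientGroup.induction_on
        induction b using QuotientGroup.induction_on
        intro hab
        exact QuotientGroup.eq.2 ((hrel _ _).2 (QuotientGroup.eq.1 hab))
      · intro b
        induction b using QuotientGroup.induction_on with
        | H b => exact ⟨((b * x : G) : G ⧸ Q.H), congrArg _ (mul_inv_cancel_right b x)⟩
    rw [← Equiv.sum_comp (Equiv.ofBijective e he) (fun d => Q'.idem d)]
    refine Finset.sum_congr rfl fun d _ => ?_
    rw [← idem_mk]
    congr 1
    conv_rhs => rw [← Quotient.out_eq d]
    rfl
  · refine Submodule.span_le.2 ?_ (gen_mem_span (Q := Q') v)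
    rintro _ ⟨⟨g, f⟩, rfl⟩
    have hf : x⁻¹ * f * x ∈ Q.F := (hF _).2 (by simp [mul_assoc])
    have h1 : Q'.gen g f = ((c ⟨_, hf⟩)⁻¹ : kˣ) •
        Q'.act (g * x) ((c ⟨_, hf⟩ : k) • Q'.gen x⁻¹ (σ ⟨_, hf⟩)) := by
      have h2 : σ ⟨_, hf⟩ = f := Subtype.ext (by simp [σ, mul_assoc])
      rw [map_smul, act_gen, mul_inv_cancel_right, h2, ← Units.smul_def, inv_smul_smul]
    change Q'.gen g f ∈ _
    rw [h1]
    exact Submodule.smul_mem _ _ (Submodule.subset_span ⟨(g * x, ⟨_, hf⟩), rfl⟩)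
  · change Q'.trace (Q'.act g ((c f : k) • Q'.gen x⁻¹ (σ f))) = _
    rw [map_smul, act_gen, map_smul, trace_gen]
    simp only [hσi]
    split_ifs with h
    · simp [h, hc1]
    · simp

/-- The ideal cut out by `a_{g,1}` has at most one dimension in each degree. Generators from other
cosets are killed, and one from `gH` is a multiple of some `a_{g,f}`, where `f` is determined by the
degree `gfg⁻¹`. -/
theorem gen_one_mul_proj (g x : G) (w : Q.Carrier) :
    Q.mul (Q.gen g 1) (Q.proj x w) = 0 ∨
      ∃ (f : Q.F) (s : k), Q.degree g f = x ∧ Q.mul (Q.gen g 1) (Q.proj x w) = s • Q.gen g f := by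
  classical
  have hH : ∀ (h : Q.H) (f : Q.F), Q.mul (Q.gen g 1) (Q.proj x (Q.gen (g * h) f)) =
      if Q.degree g (Q.conj h f) = x then (Q.ε h f : k) • Q.gen g (Q.conj h f) else 0 := fun h f => by
    rw [gen_mul, map_smul, proj_gen, map_smul]
    split_ifs
    · rw [mul_gen_same, γ_one_left]; simp
    · simp
  have hN : ∀ g' f, g⁻¹ * g' ∉ Q.H → Q.mul (Q.gen g 1) (Q.proj x (Q.gen g' f)) = 0 := fun g' f h => by
    rw [proj_gen]
    split_ifs
    · exact mul_gen_of_notMem _ h _ _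
    · exact map_zero _
  by_cases hx : ∃ f : Q.F, Q.degree g f = x
  · right
    obtain ⟨f, hf⟩ := hx
    have key : (Submodule.span k {Q.gen g f}).mkQ ∘ₗ Q.mul (Q.gen g 1) ∘ₗ Q.proj x = 0 := by
      refine Q.ext fun g' f' => (Submodule.Quotient.mk_eq_zero _).2 ?_
      change Q.mul (Q.gen g 1) (Q.proj x (Q.gen g' f')) ∈ _
      by_cases h : g⁻¹ * g' ∈ Q.H
      · obtain ⟨u, rfl⟩ : ∃ u : Q.H, g' = g * u := ⟨⟨_, h⟩, by simp⟩
        rw [hH]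
        split_ifs with h1
        · have h2 : Q.conj u f' = f := Subtype.ext (by simpa [degree] using h1.trans hf.symm)
          rw [h2]
          exact Submodule.smul_mem _ _ (Submodule.mem_span_singleton_self _)
        · exact Submodule.zero_mem _
      · rw [hN _ _ h]
        exact Submodule.zero_mem _
    obtain ⟨s, hs⟩ := Submodule.mem_span_singleton.1
      ((Submodule.Quotient.mk_eq_zero _).1 (LinearMap.congr_fun key w))
    exact ⟨f, s, hf, hs.symm⟩
  · left
    push Not at hx
    refine LinearMap.congr_fun (f := Q.mul (Q.gen g 1) ∘ₗ Q.proj x) (g := 0) (Q.ext fun g' f' => ?_) w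
    by_cases h : g⁻¹ * g' ∈ Q.H
    · obtain ⟨u, rfl⟩ : ∃ u : Q.H, g' = g * u := ⟨⟨_, h⟩, by simp⟩
      exact (hH _ _).trans (if_neg (hx _))
    · exact hN _ _ h

/-- This is the primitivity of `a_{g,1}` in the degree-one component. -/
theorem gen_one_mul_of_proj_one (g : G) {w : Q.Carrier} (hw : Q.proj 1 w = w) :
    ∃ s : k, Q.mul (Q.gen g 1) w = s • Q.gen g 1 := by
  rcases Q.gen_one_mul_proj g 1 w with h | ⟨f, s, hf, hs⟩
  · exact ⟨0, by rwa [zero_smul, ← hw]⟩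
  · have : f = 1 := by simpa [degree] using hf
    subst this
    exact ⟨s, by rwa [hw] at hs⟩

section Iso

variable (i : Q.algebra ≅ Q'.algebra)

/-- The linear map underlying an isomorphism of algebras. -/
def isoLin : Q.Carrier →ₗ[k] Q'.Carrier := i.hom.hom.lin

theorem isoLin_mul (a b : Q.Carrier) : isoLin i (Q.mul a b) = Q'.mul (isoLin i a) (isoLin i b) :=
  hom_mul i.hom a b

theorem isoLin_act (g : G) (a : Q.Carrier) : isoLin i (Q.act g a) = Q'.act g (isoLin i a) :=
  i.hom.hom.lin_act g a

theorem isoLin_proj (g : G) (a : Q.Carrier) : isoLin i (Q.proj g a) = Q'.proj g (isoLin i a) :=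
  i.hom.hom.lin_proj g a

theorem isoLin_injective : Function.Injective (isoLin i) := iso_hom_injective i

theorem isoLin_isoLin_symm (a : Q'.Carrier) : isoLin i (isoLin i.symm a) = a := iso_inv_hom i.symm a

theorem isoLin_symm (a : Q.Carrier) : isoLin i.symm (isoLin i a) = a := iso_inv_hom i a

theorem mul_one_right (a : Q.Carrier) : Q.mul a Q.one = a :=
  LinearMap.congr_fun (f := Q.mul.flip Q.one) (g := LinearMap.id)
    (Q.ext fun g f => Q.gen_mul_one g f) a

/-- The image `v` is a primitive idempotent of degree one. As the unit is the sum of the `a'_{y,1}`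
over cosets, some product `v a'_{y,1}` is non-zero. It is a multiple of both factors, so they are
proportional, and proportional non-zero idempotents coincide. -/
theorem exists_isoLin_gen_one : ∃ y, isoLin i (Q.gen 1 1) = Q'.gen y 1 := by
  classical
  set v := isoLin i (Q.gen 1 1) with hv
  have hv1 : Q'.proj 1 v = v := by
    rw [hv, ← isoLin_proj, proj_gen, if_pos (by simp [degree])]
  have hv0 : v ≠ 0 := fun h => Q.gen_one_ne_zero 1 (isoLin_injective i (h.trans (map_zero _).symm))
  have hvv : Q'.mul v v = v := by
    rw [hv, ← isoLin_mul, mul_gen_same, γ_one_left, Units.val_one, one_smul, mul_one]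
  have hg : ∀ y, Q'.proj 1 (Q'.gen y 1) = Q'.gen y 1 := fun y => by
    rw [proj_gen, if_pos (by simp [degree])]
  obtain ⟨y, hy⟩ : ∃ y, Q'.mul v (Q'.gen y 1) ≠ 0 := by
    by_contra! hn
    apply hv0
    rw [← mul_one_right v, one, map_sum]
    exact Finset.sum_eq_zero fun c _ => hn _
  -- Primitivity of `v` is that of `a_{1,1}`, transported from the source along the inverse
  -- isomorphism.
  obtain ⟨s, hs⟩ : ∃ s : k, Q'.mul v (Q'.gen y 1) = s • v := by
    have h1 : Q.proj 1 (isoLin i.symm (Q'.gen y 1)) = isoLin i.symm (Q'.gen y 1) := by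
      rw [← isoLin_proj, hg]
    obtain ⟨s, hs⟩ := gen_one_mul_of_proj_one 1 h1
    refine ⟨s, ?_⟩
    have := congrArg (isoLin i) hs
    rwa [isoLin_mul, map_smul, isoLin_isoLin_symm] at this
  obtain ⟨s', hs'⟩ := gen_one_mul_of_proj_one y hv1
  have hcomm : Q'.mul v (Q'.gen y 1) = Q'.mul (Q'.gen y 1) v := by
    have := mul_comm_of_mem (A := Q'.algebra) Q'.isCommMonObj_algebra (hg y) v
    change Q'.mul (Q'.gen y 1) v = Q'.mul (Q'.act 1 v) (Q'.gen y 1) at this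
    rw [this, map_one, Module.End.one_apply]
  rw [← hcomm, hs] at hs'
  have hs0 : s ≠ 0 := fun h => hy (by rw [hs, h, zero_smul])
  obtain ⟨r, hr⟩ : ∃ r : k, v = r • Q'.gen y 1 := ⟨s⁻¹ * s', by
    rw [mul_smul, ← hs', inv_smul_smul₀ hs0]⟩
  have hr0 : r ≠ 0 := fun h => hv0 (by rw [hr, h, zero_smul])
  rw [hr, map_smul, map_smul, LinearMap.smul_apply, mul_gen_same, γ_one_left, Units.val_one,
    one_smul, mul_one] at hvv
  refine ⟨y, ?_⟩
  rw [hr]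
  have := smul_right_injective _ hr0 hvv
  exact this

/-- The image is non-zero, homogeneous of degree `gfg⁻¹` and fixed by multiplication with
`a'_{g',1}`, so it lies on the line described by `gen_one_mul_proj`. -/
theorem exists_isoLin_gen {g g' : G} (h : isoLin i (Q.gen g 1) = Q'.gen g' 1) (f : Q.F) :
    ∃ (f' : Q'.F) (c : kˣ), Q'.degree g' f' = Q.degree g f ∧
      isoLin i (Q.gen g f) = (c : k) • Q'.gen g' f' := by
  have h1 : isoLin i (Q.gen g f) =
      Q'.mul (Q'.gen g' 1) (Q'.proj (Q.degree g f) (isoLin i (Q.gen g f))) := by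
    rw [← isoLin_proj, proj_gen_self, ← h, ← isoLin_mul, mul_gen_same, γ_one_left, Units.val_one,
      one_smul, one_mul]
  have h0 : isoLin i (Q.gen g f) ≠ 0 := fun h =>
    Q.gen_ne_zero g f (isoLin_injective i (h.trans (map_zero _).symm))
  rcases Q'.gen_one_mul_proj g' (Q.degree g f) (isoLin i (Q.gen g f)) with h2 | ⟨f', s, hf, hs⟩
  · exact absurd (h1.trans h2) h0
  · rw [← h1] at hs
    have : s ≠ 0 := fun h => h0 (by rw [hs, h, zero_smul])
    exact ⟨f', Units.mk0 s this, hf, hs⟩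

/-- With `a_{1,1} ↦ a'_{y,1}` the conjugating element is `y⁻¹`. Stabilizers of these idempotents
give `H` and `H'`, degrees in the ideals they generate give `F` and `F'`, and `c(f)` is the
coefficient in `a_{1,f} ↦ c(f) a'_{y,y⁻¹fy}`. Applying the isomorphism to products and to the action
gives the two identities. -/
theorem equivalent_of_iso (i : Q.algebra ≅ Q'.algebra) : Q.Equivalent Q' := by
  obtain ⟨y, hy⟩ := exists_isoLin_gen_one i
  have hact : ∀ g, isoLin i (Q.gen g 1) = Q'.gen (g * y) 1 := fun g => by
    rw [← act_gen, ← hy, ← isoLin_act, act_gen, mul_one]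
  have hH : ∀ h, h ∈ Q.H ↔ y⁻¹ * h * y⁻¹⁻¹ ∈ Q'.H := fun h => by
    have h1 := gen_one_eq_iff (Q := Q) 1 h
    rw [inv_one, one_mul] at h1
    rw [← h1, ← (isoLin_injective i).eq_iff, hact, hy, gen_one_eq_iff, inv_inv, mul_assoc]
  have hex := exists_isoLin_gen i hy
  have hF : ∀ f, f ∈ Q.F ↔ y⁻¹ * f * y⁻¹⁻¹ ∈ Q'.F := fun f => by
    constructor
    · intro hf
      obtain ⟨f', c, hd, -⟩ := hex ⟨f, hf⟩
      have : y⁻¹ * f * y⁻¹⁻¹ = f' := by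
        have : f = y * f' * y⁻¹ := by simpa [degree] using hd.symm
        simp [this, mul_assoc]
      rw [this]; exact f'.2
    · intro hf
      have hy' : isoLin i.symm (Q'.gen y 1) = Q.gen 1 1 := by rw [← hy, isoLin_symm]
      obtain ⟨f', c, hd, -⟩ := exists_isoLin_gen i.symm hy' ⟨_, hf⟩
      have : f = f' := by
        simpa [degree, mul_assoc] using hd.symm
      rw [this]; exact f'.2
  have hex' : ∀ f : Q.F, ∃ c : kˣ, isoLin i (Q.gen 1 f) =
      (c : k) • Q'.gen y ⟨y⁻¹ * f * y⁻¹⁻¹, (hF f).1 f.2⟩ := fun f => by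
    obtain ⟨f', c, hd, hc⟩ := hex f
    have : f' = ⟨y⁻¹ * f * y⁻¹⁻¹, (hF f).1 f.2⟩ := Subtype.ext (by
      have : (f : G) = y * f' * y⁻¹ := by simpa [degree] using hd.symm
      simp [this, mul_assoc])
    exact ⟨c, this ▸ hc⟩
  choose c hc using hex'
  refine ⟨y⁻¹, hH, hF, c, fun f g => ?_, fun h f => ?_⟩
  · have h1 := isoLin_mul i (Q.gen 1 f) (Q.gen 1 g)
    rw [mul_gen_same, map_smul, hc, hc, hc, map_smul, map_smul, LinearMap.smul_apply, mul_gen_same,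
      smul_smul, smul_smul, smul_smul] at h1
    have h2 : (⟨y⁻¹ * f * y⁻¹⁻¹, (hF f).1 f.2⟩ : Q'.F) * ⟨y⁻¹ * g * y⁻¹⁻¹, (hF g).1 g.2⟩ =
        ⟨y⁻¹ * (f * g : Q.F) * y⁻¹⁻¹, (hF _).1 (f * g).2⟩ := Subtype.ext (by simp [mul_assoc])
    rw [h2] at h1
    have h3 := smul_left_injective k (Q'.gen_ne_zero y _) h1
    refine Units.ext ?_
    push_cast
    linear_combination h3
  · have h1 := isoLin_act i h (Q.gen 1 f)
    have e1 : (h : G) * 1 = 1 * h := by simp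
    have e2 : (h : G) * y = y * (⟨y⁻¹ * h * y⁻¹⁻¹, (hH h).1 h.2⟩ : Q'.H) := by simp [mul_assoc]
    have e3 : Q'.conj ⟨y⁻¹ * h * y⁻¹⁻¹, (hH h).1 h.2⟩ ⟨y⁻¹ * f * y⁻¹⁻¹, (hF f).1 f.2⟩ =
        ⟨y⁻¹ * (Q.conj h f) * y⁻¹⁻¹, (hF _).1 (Q.conj h f).2⟩ :=
      Subtype.ext (by simp [conjOn, mul_assoc])
    rw [act_gen, e1, gen_mul, map_smul, hc, hc, map_smul, act_gen, e2, gen_mul, smul_smul,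
      smul_smul, e3] at h1
    exact Units.ext (smul_left_injective k (Q'.gen_ne_zero y _) h1)

end Iso

end Quadruple

/-! ### Idempotents of degree one: regularity, primitive idempotents, direct summands. -/

namespace GradedAlgebra

variable {k G : Type u} [Field k] [Group G] [Fintype G] {A : Mon (ZObj k G)}

theorem mul_comm_of_degree_one (hc : IsCommMonObj A.X) {a : A.X.V} (ha : A.X.proj 1 a = a)
    (b : A.X.V) : a * b = b * a := by
  rw [mul_comm_of_mem hc ha, map_one, Module.End.one_apply]

theorem proj_act_one {a : A.X.V} (ha : A.X.proj 1 a = a) (g : G) :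
    A.X.proj 1 (A.X.act g a) = A.X.act g a := by
  simpa using proj_act_of_mem ha g

/-- The Casimir identity `∑ a xᵢ ⊗ yᵢ = ∑ xᵢ ⊗ yᵢ a`, tested on `B`. Expanding `a xᵢ` in the `xⱼ`
and `yⱼ a` in the `yᵢ` gives the same double sum with coefficients `t(yⱼ a xᵢ)`. -/
theorem sum_bilin_dual {t : A.X.V →ₗ[k] k} {S : Finset (A.X.V × A.X.V)}
    (h1 : ∀ a, ∑ i ∈ S, t (a * i.1) • i.2 = a) (h2 : ∀ a, ∑ i ∈ S, t (i.2 * a) • i.1 = a)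
    (B : A.X.V →ₗ[k] A.X.V →ₗ[k] A.X.V) (a : A.X.V) :
    ∑ i ∈ S, B (a * i.1) i.2 = ∑ i ∈ S, B i.1 (i.2 * a) := by
  have e1 : ∀ i : A.X.V × A.X.V, B (a * i.1) i.2 = ∑ j ∈ S, t (j.2 * (a * i.1)) • B j.1 i.2 := fun i => by
    conv_lhs => rw [← h2 (a * i.1)]
    simp [LinearMap.sum_apply]
  have e2 : ∀ j : A.X.V × A.X.V, B j.1 (j.2 * a) = ∑ i ∈ S, t (j.2 * a * i.1) • B j.1 i.2 := fun j => by
    conv_lhs => rw [← h1 (j.2 * a)]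
    simp
  simp only [e1, e2]
  rw [Finset.sum_comm]
  simp only [mul_assoc]

/-- A linear endomorphism of a vector space has a generalised inverse. -/
theorem exists_generalizedInverse {V : Type*} [AddCommGroup V] [Module k V] (f : V →ₗ[k] V) :
    ∃ g : V →ₗ[k] V, ∀ v, f (g (f v)) = f v := by
  obtain ⟨g, hg⟩ := f.rangeRestrict.exists_rightInverse_of_surjective f.range_rangeRestrict
  obtain ⟨g', hg'⟩ := LinearMap.exists_extend g
  refine ⟨g', fun v => ?_⟩
  have h1 : g' (f v) = g (f.rangeRestrict v) := LinearMap.congr_fun hg' (f.rangeRestrict v)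
  rw [h1]
  exact congrArg Subtype.val (LinearMap.congr_fun hg (f.rangeRestrict v))

/-- The component of degree `1` of a commutative separable algebra is von Neumann regular. -/
theorem exists_regular (hc : IsCommMonObj A.X) (hs : IsSeparableAlgebra A) {z : A.X.V}
    (hz : A.X.proj 1 z = z) : ∃ w, A.X.proj 1 w = w ∧ z * z * w = z := by
  obtain ⟨t, S, -, -, h1, h2, h3⟩ := exists_dual_of_isSeparableAlgebra hs
  have hzc := mul_comm_of_degree_one hc hz
  -- A merely linear `s` with `z s(z v) = z v` is averaged over the copairing, as in Maschke's
  -- theorem. The Casimir identity for `B(a,b) = a z s(b)` becomes `z² ∑ xᵢ s(yᵢ) = ∑ xᵢ z yᵢ = z`;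
  -- the degree-one part of `∑ xᵢ s(yᵢ)` serves as `w`.
  obtain ⟨s, hs⟩ := exists_generalizedInverse (LinearMap.mulLeft k z)
  simp only [LinearMap.mulLeft_apply] at hs
  have key : ∑ i ∈ S, z * i.1 * (z * s i.2) = ∑ i ∈ S, i.1 * (z * s (i.2 * z)) :=
    sum_bilin_dual h1 h2
      ((LinearMap.mul k A.X.V).compl₁₂ LinearMap.id (LinearMap.mulLeft k z ∘ₗ s)) z
  have hr : ∑ i ∈ S, i.1 * (z * s (i.2 * z)) = z := by
    have : ∀ i : A.X.V × A.X.V, i.1 * (z * s (i.2 * z)) = z * (i.1 * i.2) := fun i => by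
      rw [← hzc i.2, hs, ← mul_assoc, ← hzc, mul_assoc]
    simp only [this, ← Finset.mul_sum, h3, mul_one]
  have hl : ∑ i ∈ S, z * i.1 * (z * s i.2) = z * z * ∑ i ∈ S, i.1 * s i.2 := by
    rw [Finset.mul_sum]
    refine Finset.sum_congr rfl fun i _ => ?_
    rw [mul_assoc z i.1, ← mul_assoc i.1, ← hzc i.1, mul_assoc z i.1, mul_assoc z z]
  have hw : z * z * ∑ i ∈ S, i.1 * s i.2 = z := by rw [← hl, key, hr]
  refine ⟨A.X.proj 1 (∑ i ∈ S, i.1 * s i.2), A.X.proj_self _ _, ?_⟩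
  have hzz : A.X.proj 1 (z * z) = z * z := by simpa using proj_mul_of_mem hz hz
  have := proj_mul_of_left hzz 1 (∑ i ∈ S, i.1 * s i.2)
  rw [hw, hz, inv_one, one_mul] at this
  exact this.symm

/-- A primitive idempotent of the component of degree `1`. -/
structure IsPrimitive (p : A.X.V) : Prop where
  ne_zero : p ≠ 0
  idem : p * p = p
  deg : A.X.proj 1 p = p
  mul_eq : ∀ b, A.X.proj 1 b = b → ∃ s : k, p * b = s • p

/-- Among non-zero idempotents of degree one take `p` with `p A` of least dimension. For `b` of
degree one, multiplication by `p b` on `p A` has an eigenvalue `s`, and `z = p b - s p` must vanish: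
otherwise regularity yields an idempotent generating a smaller non-zero ideal. -/
theorem exists_isPrimitive [IsAlgClosed k] (hc : IsCommMonObj A.X) (hs : IsSeparableAlgebra A)
    [Nontrivial A.X.V] : ∃ p : A.X.V, IsPrimitive p := by
  let r : A.X.V → ℕ := fun p => Module.finrank k (LinearMap.range (LinearMap.mulLeft k p))
  obtain ⟨p, ⟨hp0, hpp, hp1⟩, hmin⟩ := (measure r).wf.has_min
    {p | p ≠ 0 ∧ p * p = p ∧ A.X.proj 1 p = p} ⟨1, one_ne_zero, one_mul 1, proj_one⟩
  refine ⟨p, hp0, hpp, hp1, fun b hb => ?_⟩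
  have hpc := mul_comm_of_degree_one hc hp1
  set V := LinearMap.range (LinearMap.mulLeft k p) with hV
  have hVmem : ∀ v ∈ V, p * v = v := by
    rintro _ ⟨a, rfl⟩
    rw [LinearMap.mulLeft_apply, ← mul_assoc, hpp]
  have hVnt : Nontrivial V := ⟨⟨⟨p, p, hpp⟩, 0, fun h => hp0 (congrArg Subtype.val h)⟩⟩
  let T : V →ₗ[k] V := (LinearMap.mulLeft k (p * b)).restrict (fun v hv =>
    ⟨b * v, by simp⟩)
  obtain ⟨s, hs'⟩ := Module.End.exists_eigenvalue T
  obtain ⟨⟨v, hv⟩, hTv⟩ := hs'.exists_hasEigenvector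
  have hv0 : v ≠ 0 := fun h => hTv.2 (Subtype.ext h)
  have hbv : p * b * v = s • v := congrArg Subtype.val hTv.apply_eq_smul
  refine ⟨s, sub_eq_zero.1 ?_⟩
  have hz1 : A.X.proj 1 (p * b - s • p) = p * b - s • p := by
    have := proj_mul_of_mem hp1 hb
    rw [one_mul] at this
    rw [map_sub, map_smul, this, hp1]
  obtain ⟨w, hw1, hw⟩ := exists_regular hc hs hz1
  set z := p * b - s • p with hz
  have hzc := mul_comm_of_degree_one hc hz1
  have hzv : z * v = 0 := by
    rw [hz, sub_mul, hbv, smul_mul_assoc, hVmem v hv, sub_self]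
  have hpz : p * z = z := by
    rw [hz, mul_sub, ← mul_assoc, hpp, mul_smul_comm, hpp]
  have he : z * w * (z * w) = z * w := by
    rw [← mul_assoc, mul_assoc z w z, ← hzc w, ← mul_assoc z z w, hw]
  have hpe : p * (z * w) = z * w := by rw [← mul_assoc, hpz]
  -- The idempotent `z w` lies in `p A` but kills the eigenvector `v`, so its ideal is strictly
  -- smaller than `p A`, and minimality forces it to be zero. Then `z = z (z w) = 0`.
  have he0 : z * w = 0 := by
    by_contra hne
    refine hmin (z * w) ⟨hne, he, by simpa using proj_mul_of_mem hz1 hw1⟩ ?_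
    refine Submodule.finrank_lt_finrank_of_lt (lt_of_le_of_ne ?_ ?_)
    · rintro _ ⟨a, rfl⟩
      exact ⟨z * w * a, by rw [LinearMap.mulLeft_apply, LinearMap.mulLeft_apply, ← mul_assoc, hpe]⟩
    · intro h
      rw [hV, ← h] at hv
      obtain ⟨a, ha⟩ := hv
      apply hv0
      have h1 : z * w * v = v := by
        rw [← ha, LinearMap.mulLeft_apply, ← mul_assoc, he]
      rw [← h1, hzc w, mul_assoc, hzv, mul_zero]
  rw [← hw, mul_assoc, he0, mul_zero]

/-- The direct summand `eA` of an algebra given by an invariant central idempotent. -/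
def corner (A : Mon (ZObj k G)) (e : A.X.V) (hc : ∀ a, e * a = a * e) (he : e * e = e)
    (hp : A.X.proj 1 e = e) (ha : ∀ g, A.X.act g e = e) : Mon (ZObj k G) :=
  have hmem : ∀ v ∈ LinearMap.range (LinearMap.mulLeft k e), e * v = v := by
    rintro _ ⟨a, rfl⟩
    rw [LinearMap.mulLeft_apply, ← mul_assoc, he]
  have hmem' : ∀ v, e * v = v → v ∈ LinearMap.range (LinearMap.mulLeft k e) := fun v hv => ⟨v, hv⟩
  ofMul
    { V := LinearMap.range (LinearMap.mulLeft k e)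
      proj g := (A.X.proj g).restrict (fun v hv => hmem' _ (by
        have := proj_mul_of_left hp g v
        rw [hmem v hv, inv_one, one_mul] at this
        exact this.symm))
      act :=
        { toFun g := (A.X.act g).restrict (fun v hv => hmem' _ (by
            conv_lhs => rw [← ha g, ← act_mul, hmem v hv]))
          map_one' := LinearMap.ext fun v => Subtype.ext (by simp)
          map_mul' g h := LinearMap.ext fun v => Subtype.ext (by simp) }
      proj_self g v := Subtype.ext (A.X.proj_self g v)
      proj_of_ne g h v hgh := Subtype.ext (A.X.proj_of_ne g h v hgh)
      sum_proj v := Subtype.ext (by simpa using A.X.sum_proj v)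
      act_proj f g v := Subtype.ext (A.X.act_proj f g v) }
    (LinearMap.mk₂ k (fun a b => ⟨(a : A.X.V) * b, hmem' _ (by rw [← mul_assoc, hmem a a.2])⟩)
      (fun a b c => Subtype.ext (add_mul (a : A.X.V) b c))
      (fun r a b => Subtype.ext (smul_mul_assoc r (a : A.X.V) b))
      (fun a b c => Subtype.ext (mul_add (a : A.X.V) b c))
      (fun r a b => Subtype.ext (mul_smul_comm r (a : A.X.V) b)))
    ⟨e, hmem' _ he⟩
    (fun g a b => Subtype.ext (by simpa using sum_proj_mul_proj g (a : A.X.V) b))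
    (fun g a b => Subtype.ext (act_mul g (a : A.X.V) b).symm)
    (Subtype.ext hp) (fun g => Subtype.ext (ha g))
    (fun a => Subtype.ext (hmem a a.2)) (fun a => Subtype.ext ((hc a).symm.trans (hmem a a.2)))
    (fun a b c => Subtype.ext (mul_assoc (a : A.X.V) b c))

/-- The projection of an algebra onto a direct summand. -/
def toCorner (A : Mon (ZObj k G)) (e : A.X.V) (hc : ∀ a, e * a = a * e) (he : e * e = e)
    (hp : A.X.proj 1 e = e) (ha : ∀ g, A.X.act g e = e) : A ⟶ corner A e hc he hp ha :=
  homMk (B := corner A e hc he hp ha) (LinearMap.mulLeft k e).rangeRestrict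
    (fun g a => Subtype.ext (by
      have := proj_mul_of_left hp g a
      rw [inv_one, one_mul] at this
      exact this.symm))
    (fun g a => Subtype.ext (by
      change e * A.X.act g a = A.X.act g (e * a)
      rw [act_mul, ha]))
    (Subtype.ext (by
      refine Eq.trans (b := e) (mul_one e) ?_
      exact (congrArg Subtype.val (one_smul k (⟨e, e, he⟩ : LinearMap.range (LinearMap.mulLeft k e)))).symm))
    (fun a b => Subtype.ext (by
      change e * (a * b) = e * a * (e * b)
      rw [hc a, mul_assoc, ← mul_assoc e e b, he, ← mul_assoc, hc a, mul_assoc]))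

/-- Otherwise `e A` and `(1 - e) A` would decompose `A` into two non-zero algebras. -/
theorem eq_one_of_isIndecomposableAlgebra (h : IsIndecomposableAlgebra A) {e : A.X.V} (h0 : e ≠ 0)
    (hc : ∀ a, e * a = a * e) (he : e * e = e)
    (hp : A.X.proj 1 e = e) (ha : ∀ g, A.X.act g e = e) : e = 1 := by
  have hc' : ∀ a, (1 - e) * a = a * (1 - e) := fun a => by rw [sub_mul, mul_sub, hc, one_mul, mul_one]
  have he' : (1 - e) * (1 - e) = 1 - e := by rw [mul_sub, mul_one, sub_mul, one_mul, he, sub_self, sub_zero]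
  have hp' : A.X.proj 1 (1 - e) = 1 - e := by rw [map_sub, proj_one, hp]
  have ha' : ∀ g, A.X.act g (1 - e) = 1 - e := fun g => by rw [map_sub, act_one, ha]
  have hb : Function.Bijective (fun a : A.X.V => ((toCorner A e hc he hp ha).hom.lin a,
      (toCorner A (1 - e) hc' he' hp' ha').hom.lin a)) := by
    constructor
    · intro a b hab
      have h1 : e * a = e * b := congrArg (fun x => Subtype.val (Prod.fst x)) hab
      have h2 : (1 - e) * a = (1 - e) * b := congrArg (fun x => Subtype.val (Prod.snd x)) hab
      rw [sub_mul, sub_mul, h1, one_mul, one_mul] at h2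
      exact sub_left_injective h2
    · rintro ⟨⟨_, a, rfl⟩, ⟨_, b, rfl⟩⟩
      refine ⟨e * a + (1 - e) * b, Prod.ext (Subtype.ext ?_) (Subtype.ext ?_)⟩
      · change e * (e * a + (1 - e) * b) = e * a
        rw [mul_add, ← mul_assoc, ← mul_assoc, he, mul_sub, he, mul_one, sub_self, zero_mul, add_zero]
      · change (1 - e) * (e * a + (1 - e) * b) = (1 - e) * b
        rw [mul_add, ← mul_assoc, ← mul_assoc, he', sub_mul, he, one_mul, sub_self, zero_mul, zero_add]
  rcases h.2 _ _ _ _ hb with hB | hC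
  · exact absurd (congrArg Subtype.val (hB.elim (⟨e, e, he⟩ : LinearMap.range (LinearMap.mulLeft k e))
      (0 : LinearMap.range (LinearMap.mulLeft k e)))) h0
  · have := congrArg Subtype.val (hC.elim
      (⟨1 - e, 1 - e, he'⟩ : LinearMap.range (LinearMap.mulLeft k (1 - e)))
      (0 : LinearMap.range (LinearMap.mulLeft k (1 - e))))
    exact (sub_eq_zero.1 this).symm

end GradedAlgebra

/-! ### The structure of `p A` for a primitive idempotent `p`, and the resulting quadruple. -/

namespace GradedAlgebra

variable {k G : Type u} [Field k] [Group G] [Fintype G] {A : Mon (ZObj k G)} {p : A.X.V}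

/-- An invariant functional supported in degree `1` whose associated pairing is non-degenerate. -/
structure IsTrace (t : A.X.V →ₗ[k] k) : Prop where
  map_proj : ∀ g a, g ≠ 1 → t (A.X.proj g a) = 0
  map_act : ∀ g a, t (A.X.act g a) = t a
  nondegenerate : ∀ a, (∀ b, t (a * b) = 0) → a = 0

theorem exists_isTrace (hs : IsSeparableAlgebra A) : ∃ t : A.X.V →ₗ[k] k, IsTrace t := by
  obtain ⟨t, S, h1, h2, h3, -, -⟩ := exists_dual_of_isSeparableAlgebra hs
  refine ⟨t, h1, h2, fun a ha => ?_⟩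
  rw [← h3 a]
  exact Finset.sum_eq_zero fun i _ => by rw [ha, zero_smul]

theorem IsTrace.map_proj_one {t : A.X.V →ₗ[k] k} (ht : IsTrace t) (a : A.X.V) :
    t (A.X.proj 1 a) = t a := by
  conv_rhs => rw [← A.X.sum_proj a, map_sum]
  rw [Finset.sum_eq_single 1 (fun b _ hb => ht.map_proj b a hb) (by simp)]

theorem units_eq_of_smul_eq {V : Type*} [AddCommGroup V] [Module k V] {v : V} (hv : v ≠ 0)
    {a b : kˣ} (h : (a : k) • v = (b : k) • v) : a = b :=
  Units.ext (smul_left_injective k hv h)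

namespace IsPrimitive

/-- Both `p` and its translate are primitive, so their product is a multiple of each. If it is
non-zero they are proportional idempotents, hence equal. -/
theorem act_eq_or_mul_act_eq_zero (hc : IsCommMonObj A.X) (hp : IsPrimitive p)
    (g : G) : A.X.act g p = p ∨ p * A.X.act g p = 0 := by
  have hpc := mul_comm_of_degree_one hc hp.deg
  have hgg : A.X.act g p * A.X.act g p = A.X.act g p := by rw [← act_mul, hp.idem]
  obtain ⟨s, hs⟩ := hp.mul_eq _ (proj_act_one hp.deg g)
  obtain ⟨r, hr⟩ := hp.mul_eq _ (proj_act_one hp.deg g⁻¹)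
  have hr' : p * A.X.act g p = r • A.X.act g p := by
    have := congrArg (A.X.act g) hr
    rwa [act_mul, A.X.act_act_inv, map_smul, ← hpc] at this
  by_cases hs0 : s = 0
  · right; rw [hs, hs0, zero_smul]
  left
  have h1 : p = (s⁻¹ * r) • A.X.act g p := by rw [mul_smul, ← hr', hs, inv_smul_smul₀ hs0]
  have hn : s⁻¹ * r ≠ 0 := fun h => hp.ne_zero (by rw [h1, h, zero_smul])
  generalize s⁻¹ * r = n at h1 hn
  have h2 := hp.idem
  rw [h1, smul_mul_assoc, mul_smul_comm, hgg] at h2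
  conv_rhs => rw [h1]
  exact (smul_right_injective _ hn h2).symm

/-- Non-zero homogeneous elements of `pA` are invertible in `pA`. -/
theorem exists_right_inverse (hc : IsCommMonObj A.X) (hp : IsPrimitive p)
    {t : A.X.V →ₗ[k] k} (ht : IsTrace t) {g : G} {v : A.X.V} (hv : v ≠ 0)
    (hpv : p * v = v) (hg : A.X.proj g v = v) :
    ∃ w, p * w = w ∧ A.X.proj g⁻¹ w = w ∧ v * w = p := by
  have hpc := mul_comm_of_degree_one hc hp.deg
  -- Since `t` only sees degree one, `b` may be replaced by its component of degree `g⁻¹`. Then `v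
  -- b` has degree one and lies in `p A`, so it is a multiple of `p`, non-zero because its trace is.
  obtain ⟨b, hb⟩ : ∃ b, t (v * b) ≠ 0 := by
    by_contra! h
    exact hv (ht.nondegenerate v h)
  rw [← ht.map_proj_one, proj_mul_of_left hg, mul_one] at hb
  have hb1 : A.X.proj g⁻¹ (A.X.proj g⁻¹ b) = A.X.proj g⁻¹ b := A.X.proj_self _ _
  generalize A.X.proj g⁻¹ b = b at hb hb1
  have hvb : A.X.proj 1 (v * b) = v * b := by simpa using proj_mul_of_mem hg hb1
  obtain ⟨s, hs⟩ := hp.mul_eq _ hvb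
  rw [← mul_assoc, hpv] at hs
  have hs0 : s ≠ 0 := fun h => hb (by rw [hs, h, zero_smul, map_zero])
  refine ⟨s⁻¹ • (p * b), ?_, ?_, ?_⟩
  · rw [mul_smul_comm, ← mul_assoc, hp.idem]
  · rw [map_smul]
    congr 1
    simpa using proj_mul_of_mem hp.deg hb1
  · rw [mul_smul_comm, ← mul_assoc, ← hpc, hpv, hs, inv_smul_smul₀ hs0]

/-- The right inverse `w` works: `w v` has degree one in `p A`, so `w v = s p`, and `v = (v w) v = v
(w v) = s v` gives `s = 1`. -/
theorem exists_left_inverse (hc : IsCommMonObj A.X) (hp : IsPrimitive p)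
    {t : A.X.V →ₗ[k] k} (ht : IsTrace t) {g : G} {v : A.X.V} (hv : v ≠ 0)
    (hpv : p * v = v) (hg : A.X.proj g v = v) :
    ∃ w, p * w = w ∧ A.X.proj g⁻¹ w = w ∧ w * v = p := by
  have hpc := mul_comm_of_degree_one hc hp.deg
  obtain ⟨w, hpw, hw, hvw⟩ := exists_right_inverse hc hp ht hv hpv hg
  refine ⟨w, hpw, hw, ?_⟩
  have hwv : A.X.proj 1 (w * v) = w * v := by simpa using proj_mul_of_mem hw hg
  obtain ⟨s, hs⟩ := hp.mul_eq _ hwv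
  rw [← mul_assoc, hpw] at hs
  have h1 : s • v = (1 : k) • v := by
    have : v * (w * v) = v := by rw [← mul_assoc, hvw, hpv]
    rw [hs, mul_smul_comm, ← hpc, hpv] at this
    rw [this, one_smul]
  have h2 : s = 1 := smul_left_injective k hv h1
  rw [hs, h2, one_smul]

/-- Dividing by `v` moves `v'` to degree one, where `p A` is the line `k p`. -/
theorem exists_eq_smul (hc : IsCommMonObj A.X) (hp : IsPrimitive p)
    {t : A.X.V →ₗ[k] k} (ht : IsTrace t) {g : G} {v : A.X.V} (hv : v ≠ 0)
    (hpv : p * v = v) (hg : A.X.proj g v = v) {v' : A.X.V}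
    (hpv' : p * v' = v') (hg' : A.X.proj g v' = v') : ∃ s : k, v' = s • v := by
  have hpc := mul_comm_of_degree_one hc hp.deg
  obtain ⟨w, hpw, hw, hwv⟩ := exists_left_inverse hc hp ht hv hpv hg
  have h1 : A.X.proj 1 (v' * w) = v' * w := by simpa using proj_mul_of_mem hg' hw
  obtain ⟨s, hs⟩ := hp.mul_eq _ h1
  rw [← mul_assoc, hpv'] at hs
  refine ⟨s, ?_⟩
  calc v' = v' * (w * v) := by rw [hwv, ← hpc, hpv']
    _ = s • v := by rw [← mul_assoc, hs, smul_mul_assoc, hpv]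

theorem mul_ne_zero (hc : IsCommMonObj A.X) (hp : IsPrimitive p)
    {t : A.X.V →ₗ[k] k} (ht : IsTrace t) {g : G} {v w : A.X.V} (hv : v ≠ 0)
    (hpv : p * v = v) (hg : A.X.proj g v = v) (hw : w ≠ 0) (hpw : p * w = w) : v * w ≠ 0 := by
  obtain ⟨v', -, -, h⟩ := exists_left_inverse hc hp ht hv hpv hg
  intro h0
  apply hw
  rw [← hpw, ← h, mul_assoc, h0, mul_zero]

/-- Commutativity gives `v = v p = f(p) v = f(p) p v`, so `f(p)` is not orthogonal to `p`. This is
the inclusion of `F` in `H`. -/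
theorem act_eq_of_degree (hc : IsCommMonObj A.X) (hp : IsPrimitive p) {f : G} {v : A.X.V} (hv : v ≠ 0)
    (hpv : p * v = v) (hg : A.X.proj f v = v) : A.X.act f p = p := by
  have hpc := mul_comm_of_degree_one hc hp.deg
  refine (act_eq_or_mul_act_eq_zero hc hp f).resolve_right fun h => hv ?_
  have h1 := mul_comm_of_mem hc hg p
  rw [← hpc, hpv] at h1
  rw [h1, ← hpv, ← mul_assoc, ← hpc, h, zero_mul]

end IsPrimitive

/-- The stabilizer of an element. -/
def stabilizer (p : A.X.V) : Subgroup G where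
  carrier := {g | A.X.act g p = p}
  one_mem' := by simp
  mul_mem' {a b} ha hb := by
    change A.X.act (a * b) p = p
    rw [map_mul, Module.End.mul_apply, hb, ha]
  inv_mem' {a} ha := by
    change A.X.act a⁻¹ p = p
    conv_lhs => rw [← show A.X.act a p = p from ha]
    exact A.X.act_inv_act a p

theorem mem_stabilizer {g : G} : g ∈ stabilizer p ↔ A.X.act g p = p := Iff.rfl

theorem act_out_mk (g : G) : A.X.act (g : G ⧸ stabilizer p).out p = A.X.act g p := by
  obtain ⟨h, hh⟩ := QuotientGroup.mk_out_eq_mul (stabilizer p) g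
  rw [hh, map_mul, Module.End.mul_apply, mem_stabilizer.1 h.2]

-- The orbit sum is invariant, and it is idempotent because `p` is orthogonal to its other
-- translates; indecomposability leaves only the unit.
open Classical in
theorem IsPrimitive.sum_act_eq_one (hc : IsCommMonObj A.X) (hi : IsIndecomposableAlgebra A)
    (hp : IsPrimitive p) : ∑ c : G ⧸ stabilizer p, A.X.act c.out p = 1 := by
  set s := ∑ c : G ⧸ stabilizer p, A.X.act c.out p with hs
  have hps : p * s = p := by
    rw [hs, Finset.mul_sum, Finset.sum_eq_single ((1 : G) : G ⧸ stabilizer p)]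
    · rw [act_out_mk, map_one, Module.End.one_apply, hp.idem]
    · intro c _ hne
      induction c using QuotientGroup.induction_on with
      | H g =>
        rw [act_out_mk]
        refine (act_eq_or_mul_act_eq_zero hc hp g).resolve_left fun h => hne ?_
        exact (QuotientGroup.eq.2 (by simpa using mem_stabilizer.2 h)).symm
    · simp
  have hsa : ∀ g, A.X.act g s = s := fun g => by
    rw [hs, map_sum, ← Equiv.sum_comp (MulAction.toPerm g)
      (fun c : G ⧸ stabilizer p => A.X.act c.out p)]
    refine Finset.sum_congr rfl fun c _ => ?_
    induction c using QuotientGroup.induction_on with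
    | H x =>
      rw [act_out_mk, ← Module.End.mul_apply, ← map_mul]
      exact (act_out_mk (g * x)).symm
  have hs1 : A.X.proj 1 s = s := by
    rw [hs, map_sum]
    exact Finset.sum_congr rfl fun c _ => proj_act_one hp.deg _
  refine eq_one_of_isIndecomposableAlgebra hi (fun h => hp.ne_zero ?_)
    (mul_comm_of_degree_one hc hs1) ?_ hs1 hsa
  · rw [← hps, h, mul_zero]
  · conv_lhs => enter [1]; rw [hs]
    rw [Finset.sum_mul]
    refine Finset.sum_congr rfl fun c _ => ?_
    rw [← hsa c.out, ← act_mul, hps]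

/-- The degrees of the non-zero homogeneous elements of `pA`, as a subgroup. -/
def support (hc : IsCommMonObj A.X) (hp : IsPrimitive p) {t : A.X.V →ₗ[k] k} (ht : IsTrace t) :
    Subgroup G where
  carrier := {f | ∃ v, v ≠ 0 ∧ p * v = v ∧ A.X.proj f v = v}
  one_mem' := ⟨p, hp.ne_zero, hp.idem, hp.deg⟩
  mul_mem' := by
    rintro a b ⟨v, hv, hpv, hav⟩ ⟨w, hw, hpw, hbw⟩
    exact ⟨v * w, hp.mul_ne_zero hc ht hv hpv hav hw hpw, by rw [← mul_assoc, hpv],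
      proj_mul_of_mem hav hbw⟩
  inv_mem' := by
    rintro a ⟨v, hv, hpv, hav⟩
    obtain ⟨w, hpw, hw, hvw⟩ := hp.exists_right_inverse hc ht hv hpv hav
    exact ⟨w, fun h => hp.ne_zero (by rw [← hvw, h, mul_zero]), hpw, hw⟩

theorem exists_quadruple [IsAlgClosed k] (hc : IsCommMonObj A.X)
    (hs : IsSeparableAlgebra A) (hi : IsIndecomposableAlgebra A) :
    ∃ Q : Quadruple k G, Nonempty (A ≅ Q.algebra) := by
  classical
  have := hi.1
  obtain ⟨p, hp⟩ := exists_isPrimitive hc hs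
  obtain ⟨t, ht⟩ := exists_isTrace hs
  have hpc := mul_comm_of_degree_one hc hp.deg
  set H := stabilizer p with hH
  set F := support hc hp ht with hF
  have hFH : F ≤ H := by
    rintro f ⟨v, hv, hpv, hfv⟩
    exact hp.act_eq_of_degree hc hv hpv hfv
  have hpact : ∀ h : H, ∀ v, p * v = v → p * A.X.act h v = A.X.act h v := fun h v hv => by
    conv_lhs => enter [1]; rw [← mem_stabilizer.1 h.2]
    rw [← act_mul, hv]
  have hact0 : ∀ (g : G) (v : A.X.V), v ≠ 0 → A.X.act g v ≠ 0 := fun g v hv h => hv (by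
    rw [← A.X.act_inv_act g v, h, map_zero])
  have hn : (F.subgroupOf H).Normal := ⟨by
    rintro ⟨f, hfH⟩ hf h
    obtain ⟨v, hv, hpv, hfv⟩ := Subgroup.mem_subgroupOf.1 hf
    exact Subgroup.mem_subgroupOf.2
      ⟨A.X.act h v, hact0 _ _ hv, hpact h v hpv, proj_act_of_mem hfv _⟩⟩
  -- The choice `u 1 = p` is what makes the cocycle normalised.
  have hu : ∀ f : F, ∃ v, v ≠ 0 ∧ p * v = v ∧ A.X.proj f v = v ∧ (f = 1 → v = p) := fun f => by
    by_cases hf : f = 1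
    · subst hf
      exact ⟨p, hp.ne_zero, hp.idem, hp.deg, fun _ => rfl⟩
    · obtain ⟨v, hv, hpv, hfv⟩ := f.2
      exact ⟨v, hv, hpv, hfv, fun h => absurd h hf⟩
  choose u hu0 hup hud hu1' using hu
  have hu1 : u 1 = p := hu1' 1 rfl
  have hup' : ∀ f, u f * p = u f := fun f => by rw [← hpc, hup]
  have hline : ∀ (f : F) (v : A.X.V), v ≠ 0 → p * v = v → A.X.proj f v = v →
      ∃ c : kˣ, v = (c : k) • u f := fun f v hv hpv hfv => by
    obtain ⟨s, hs⟩ := hp.exists_eq_smul hc ht (hu0 f) (hup f) (hud f) hpv hfv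
    exact ⟨Units.mk0 s (fun h => hv (by rw [hs, h, zero_smul])), hs⟩
  have hγ : ∀ f g : F, ∃ c : kˣ, u f * u g = (c : k) • u (f * g) := fun f g =>
    hline (f * g) _ (hp.mul_ne_zero hc ht (hu0 f) (hup f) (hud f) (hu0 g) (hup g))
      (by rw [← mul_assoc, hup]) (proj_mul_of_mem (hud f) (hud g))
  choose γ hγ using hγ
  have hε : ∀ (h : H) (f : F), ∃ c : kˣ, A.X.act h (u f) = (c : k) • u (conjOn hFH hn h f) :=
    fun h f => hline (conjOn hFH hn h f) _ (hact0 _ _ (hu0 f)) (hpact h _ (hup f))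
      (proj_act_of_mem (hud f) h)
  choose ε hε using hε
  -- Each axiom compares coefficients of one non-zero `u f`. The cocycle identity is associativity,
  -- `eps1` is `(gh)v = g(hv)`, `eps2` is multiplicativity of the action, and `eps3` is braided
  -- commutativity.
  let Q : Quadruple k G :=
    { H := H
      F := F
      F_le := hFH
      normal := hn
      γ := γ
      γ_one_left := fun f => by
        have h := hγ 1 f
        rw [hu1, hup, one_mul] at h
        exact units_eq_of_smul_eq (hu0 f) (by rw [← h, Units.val_one, one_smul])
      γ_one_right := fun f => by
        have h := hγ f 1
        rw [hu1, hup', mul_one] at h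
        exact units_eq_of_smul_eq (hu0 f) (by rw [← h, Units.val_one, one_smul])
      γ_cocycle := fun f g h => by
        refine units_eq_of_smul_eq (hu0 (f * g * h)) ?_
        have h1 := mul_assoc (u f) (u g) (u h)
        rw [hγ f g, hγ g h, smul_mul_assoc, mul_smul_comm, hγ, hγ, smul_smul, smul_smul,
          ← mul_assoc f] at h1
        exact_mod_cast h1
      ε := ε
      eps1 := fun g h f => by
        refine units_eq_of_smul_eq (hu0 (conjOn hFH hn (g * h) f)) ?_
        have h1 : conjOn hFH hn (g * h) f = conjOn hFH hn g (conjOn hFH hn h f) :=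
          Subtype.ext (by simp [conjOn, mul_assoc])
        rw [← hε, Subgroup.coe_mul, map_mul, Module.End.mul_apply, hε, map_smul, hε, smul_smul, h1,
          Units.val_mul, mul_comm]
      eps2 := fun h f g => by
        refine units_eq_of_smul_eq (hu0 (conjOn hFH hn h (f * g))) ?_
        have h1 : conjOn hFH hn h (f * g) = conjOn hFH hn h f * conjOn hFH hn h g :=
          Subtype.ext (by simp [conjOn])
        rw [Units.val_mul, mul_smul, ← hε, ← map_smul, ← hγ, act_mul, hε, hε, smul_mul_assoc,
          mul_smul_comm, hγ, h1, smul_smul, smul_smul, Units.val_mul, Units.val_mul, mul_assoc]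
      eps3 := fun f g => by
        refine units_eq_of_smul_eq (hu0 (f * g)) ?_
        have h1 : conjOn hFH hn ⟨f, hFH f.2⟩ g * f = f * g := Subtype.ext (by simp [conjOn])
        rw [← hγ, mul_comm_of_mem hc (hud f)]
        have h2 := hε ⟨f, hFH f.2⟩ g
        dsimp only at h2
        rw [h2, smul_mul_assoc, hγ, h1, smul_smul, Units.val_mul] }
  -- By primitivity `t(p b)` is always a multiple of `t(p)`, so `t(p) = 0` would contradict
  -- non-degeneracy. This allows the normalised functional `t / t(p)` below.
  have htp : t p ≠ 0 := fun h => hp.ne_zero (ht.nondegenerate p fun b => by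
    obtain ⟨s, hs⟩ := hp.mul_eq _ (A.X.proj_self 1 b)
    rw [← ht.map_proj_one, proj_mul_of_left hp.deg, inv_one, one_mul, hs, map_smul, h, smul_zero])
  refine ⟨Q, (Q.nonempty_algebra_iso u hud hγ hε (fun g hg => ?_) ?_ (fun v => ?_)
    ((t p)⁻¹ • t) (fun g f => ?_)).map Iso.symm⟩
  · change u (1 : F) * A.X.act g (u (1 : F)) = 0
    rw [hu1]
    exact (hp.act_eq_or_mul_act_eq_zero hc g).resolve_left hg
  · change ∑ c : G ⧸ H, A.X.act c.out (u (1 : F)) = 1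
    rw [hu1]
    exact hp.sum_act_eq_one hc hi
  -- Splitting `1` into translates of `p` and `v` into homogeneous parts leaves terms `g(p) w = g(p
  -- · g⁻¹w)`. Here `p · g⁻¹w` is homogeneous in `p A`, hence zero or a multiple of some `u f`.
  · rw [← one_mul v, ← hp.sum_act_eq_one hc hi, Finset.sum_mul]
    refine Submodule.sum_mem _ fun c _ => ?_
    rw [← A.X.sum_proj v, Finset.mul_sum]
    refine Submodule.sum_mem _ fun x _ => ?_
    generalize c.out = g
    have hx := A.X.proj_self x v
    generalize A.X.proj x v = w at hx
    have h1 : A.X.act g p * w = A.X.act g (p * A.X.act g⁻¹ w) := by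
      rw [act_mul, A.X.act_act_inv]
    have h2 : A.X.proj (g⁻¹ * x * g⁻¹⁻¹) (p * A.X.act g⁻¹ w) = p * A.X.act g⁻¹ w := by
      have := proj_mul_of_mem hp.deg (proj_act_of_mem hx g⁻¹)
      rwa [one_mul] at this
    have h3 : p * (p * A.X.act g⁻¹ w) = p * A.X.act g⁻¹ w := by rw [← mul_assoc, hp.idem]
    rw [h1]
    generalize p * A.X.act g⁻¹ w = w' at h2 h3
    by_cases h0 : w' = 0
    · rw [h0, map_zero]
      exact Submodule.zero_mem _
    · obtain ⟨s, hs⟩ := hline ⟨_, w', h0, h3, h2⟩ w' h0 h3 h2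
      rw [hs, map_smul]
      exact Submodule.smul_mem _ _ (Submodule.subset_span ⟨(g, _), rfl⟩)
  · rw [LinearMap.smul_apply, ht.map_act]
    split_ifs with h
    · rw [h]
      change (t p)⁻¹ • t (u (1 : F)) = 1
      rw [hu1, smul_eq_mul, inv_mul_cancel₀ htp]
    · rw [← hud f, ht.map_proj _ _ (fun h' => h (Subtype.ext h')), smul_zero]

end GradedAlgebra

end

/-! ### The classification theorem. -/

theorem mainTheorem1 {k G : Type u} [Field k] [IsAlgClosed k] [CharZero k] [Group G] [Fintype G] :
    (∀ Q : Quadruple k G, IsCommMonObj Q.algebra.X ∧ IsSeparableAlgebra Q.algebra ∧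
      IsIndecomposableAlgebra Q.algebra) ∧
    (∀ A : Mon (ZObj k G), IsCommMonObj A.X → IsSeparableAlgebra A → IsIndecomposableAlgebra A →
      ∃ Q : Quadruple k G, Nonempty (A ≅ Q.algebra)) ∧
    (∀ Q Q' : Quadruple k G, Nonempty (Q.algebra ≅ Q'.algebra) ↔ Q.Equivalent Q') :=
  ⟨fun Q => ⟨Q.isCommMonObj_algebra, Q.isSeparableAlgebra_algebra,
      Q.isIndecomposableAlgebra_algebra⟩,
    fun _ hc hs hi => GradedAlgebra.exists_quadruple hc hs hi,
    fun _ _ => ⟨fun ⟨i⟩ => Quadruple.equivalent_of_iso i, Quadruple.nonempty_iso_of_equivalent⟩⟩
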